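/- Let $p>1$ be odd, let $q$ be a primitive $p$-th root of unity, and let $q^{1/2}$ be the square root of $q$ with $(q^{1/2})^p=-1$. Put $[n]=\frac{q^n-q^{-n}}{q-q^{-1}}$ and $[n]!=[1][2]\cdots[n]$. Let $A(E(1,1|p))$ be the complex algebra generated by $\eta_+,\eta_-,\delta$ with relations $\eta_-\eta_+=q^2\eta_+\eta_-$, $\eta_\pm\delta=q^2\delta\eta_\pm$, $\delta^p=1$, $\eta_\pm^p=0$, with comultiplication $\Delta(\eta_\pm)=\eta_\pm\otimes 1+\delta^{\pm1}\otimes\eta_\pm$, $\Delta(\delta)=\delta\otimes\delta$. Let $A(E_q(1,1))=A(E(1,1|p))\otimes C^\infty(\mathbb R^2)$, where $C^\infty(\mathbb R^2)$ consists of the smooth complex functions of $z=(z_+,z_-)$, which commute with $\eta_\pm,\delta$. Its comultiplication is $\Delta(af)=\Delta(a)\Delta(f)$ with $$\Delta(f)=f(Z)+\tfrac{\partial f}{\partial z_+}(Z)B_++\tfrac{\partial f}{\partial z_-}(Z)B_-+\tfrac{\partial^2 f}{\partial z_+\partial z_-}(Z)B_+B_-,$$ where $Z_\pm=z_\pm\otimes1+1\otimes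 z_\pm$, $B_\pm=(-1)^{\frac{p+1}2}\sum_{n=1}^{p-1}\frac{q^{\pm n^2}}{[p-n]!\,[n]!}\,\eta_\pm^{p-n}\delta^{\pm n}\otimes\eta_\pm^n$, and the tensor square of $C^\infty(\mathbb R^2)$ is completed to $C^\infty(\mathbb R^2\times\mathbb R^2)$. The generators $p_\pm,\kappa$ of the dual algebra $U_q(e(1,1))$, with $\kappa^p=1$, $p_+p_-=p_-p_+$, $p_\pm\kappa=q^{\mp1}\kappa p_\pm$, $\Delta(\kappa)=\kappa\otimes\kappa$ and $\Delta(p_\pm)=p_\pm\otimes\kappa+\kappa^{-1}\otimes p_\pm$, are functionals on $A(E_q(1,1))$: $\langle\kappa^{\pm1},\delta\rangle=q^{\pm1}$, $\langle p_\pm,\eta_\pm\rangle=iq^{\pm1/2}$, the pairings of $\kappa^{\pm1}$ and $p_\pm$ with the other generators among $\eta_+,\eta_-,\delta$ vanish, $\langle\kappa^{\pm1},ab\rangle=\langle\kappa^{\pm1},a\rangle\langle\kappa^{\pm1},b\rangle$, $\langle p_\pm,ab\rangle=\langle p_\pm,a\rangle\langle\kappa,b\rangle+\langle\kappa^{-1},a\rangle\langle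 p_\pm,b\rangle$ for $a,b\in A(E(1,1|p))$, and $\langle p_\pm,af\rangle=\langle p_\pm,a\rangle f(0)$ for $f\in C^\infty(\mathbb R^2)$. The right representation is $\mathcal R(p_\pm)F=(p_\pm\otimes\mathrm{id})\Delta(F)$ for $F\in A(E_q(1,1))$. For $\lambda=(\lambda_+,\lambda_-)\in\mathbb C^2$ let $\mathcal L^\lambda(p_\pm)\delta^m=\lambda_\pm\delta^{m\pm1}$, $\mathcal L^\lambda(\kappa)\delta^m=q^m\delta^m$ on the algebra $A(SO(1,1|p))$ of polynomials in $\delta$ with $\delta^p=1$. Put $P_\pm=p_\pm^p$, $\epsilon_\pm=-q^{\mp1/2}p_\pm\kappa^{-1}$, $e_\pm^x=\sum_{m=0}^{p-1}\frac{q^{\pm m(m-1)/2}}{[m]!}x^m$, $D(\kappa,\delta)=\frac1p\sum_{m,k=0}^{p-1}q^{-mk}\kappa^m\otimes\delta^k$ and $$T^\lambda a=e^{-i\mathcal L^\lambda(P_+)\otimes z_+-i\mathcal L^\lambda(P_-)\otimes z_-}\;e_+^{i\mathcal L^\lambda(\epsilon_+)\otimes\eta_+}\;e_-^{i\mathcal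 L^\lambda(\epsilon_-)\otimes\eta_-}\;D(\mathcal L^\lambda(\kappa),\delta)\,(a\otimes1).$$ For $0\le m,n\le p-1$ let $D^\lambda_{mn}=\{\delta^{p-m}\otimes1,\,T^\lambda\delta^n\}_S\in A(E_q(1,1))$, where $\{a\otimes1,b\otimes G\}_S=(a,b)_S\,G$, $(a,b)_S=\mathcal I_S(a^*b)$, the involution $*$ is antilinear with $\delta^*=\delta$, and $\mathcal I_S(\delta^m)$ is $1$ if $p\mid m$ and $0$ otherwise. Then $$\mathcal R(p_+)D^\lambda_{m0}=\lambda_+D^\lambda_{m-1,0}\quad(1\le m\le p-1),\qquad \mathcal R(p_-)D^\lambda_{m0}=\lambda_-D^\lambda_{m+1,0}\quad(0\le m\le p-2),$$ $$\mathcal R(p_+)D^\lambda_{00}=\lambda_+D^\lambda_{p-1,0},\qquad \mathcal R(p_-)D^\lambda_{p-1,0}=\lambda_-D^\lambda_{00}.$$ -/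

import Mathlib

open scoped TensorProduct ContDiff

noncomputable section

namespace QPoincare

/-- The deformation parameter: an odd integer `p > 1`, a primitive `p`-th root of unity `q`, and
the square root `qh = q^{1/2}` of `q` with `(q^{1/2})^p = -1`. -/
structure RootParam where
  p : ℕ
  odd_p : Odd p
  one_lt_p : 1 < p
  q : ℂ
  qh : ℂ
  prim : IsPrimitiveRoot q p
  qh_sq : qh ^ 2 = q
  qh_pow : qh ^ p = -1

variable (Q : RootParam)

instance : NeZero Q.p := ⟨by have := Q.one_lt_p; omega⟩

namespace RootParam

theorem q_ne_zero : Q.q ≠ 0 := Q.prim.ne_zero (by have := Q.one_lt_p; omega)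

/-- `[n] = (q^n - q^{-n}) / (q - q^{-1})`. -/
def qNum (n : ℕ) : ℂ := (Q.q ^ n - (Q.q⁻¹) ^ n) / (Q.q - Q.q⁻¹)

/-- `[n]! = [1] [2] ⋯ [n]`. -/
def qFact (n : ℕ) : ℂ := ∏ k ∈ Finset.Icc 1 n, Q.qNum k

end RootParam

/-! ### The reduced quantum group: generators `η₊, η₋, δ` and relations -/

inductive Gen
  | etaP
  | etaM
  | del

open FreeAlgebra in
/-- `η₋ η₊ = q² η₊ η₋`, `η± δ = q² δ η±`, `δ^p = 1`, `η±^p = 0`. -/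
inductive Rel : FreeAlgebra ℂ Gen → FreeAlgebra ℂ Gen → Prop
  | etaM_etaP : Rel (ι ℂ Gen.etaM * ι ℂ Gen.etaP) (Q.q ^ 2 • (ι ℂ Gen.etaP * ι ℂ Gen.etaM))
  | etaP_del : Rel (ι ℂ Gen.etaP * ι ℂ Gen.del) (Q.q ^ 2 • (ι ℂ Gen.del * ι ℂ Gen.etaP))
  | etaM_del : Rel (ι ℂ Gen.etaM * ι ℂ Gen.del) (Q.q ^ 2 • (ι ℂ Gen.del * ι ℂ Gen.etaM))
  | del_pow : Rel (ι ℂ Gen.del ^ Q.p) 1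
  | etaP_pow : Rel (ι ℂ Gen.etaP ^ Q.p) 0
  | etaM_pow : Rel (ι ℂ Gen.etaM ^ Q.p) 0

/-- The algebra `A(E(1,1|p))` of the reduced quantum Poincaré group. -/
abbrev Ared : Type := RingQuot (Rel Q)

/-- The images of the generators. -/
def gen (x : Gen) : Ared Q := RingQuot.mkAlgHom ℂ (Rel Q) (FreeAlgebra.ι ℂ x)

def etaP : Ared Q := gen Q Gen.etaP
def etaM : Ared Q := gen Q Gen.etaM
def del : Ared Q := gen Q Gen.del

/-- `δ⁻¹ = δ^{p-1}`. -/
def delInv : Ared Q := del Q ^ (Q.p - 1)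

theorem etaM_mul_etaP : etaM Q * etaP Q = Q.q ^ 2 • (etaP Q * etaM Q) := by
  simpa [etaM, etaP, gen] using RingQuot.mkAlgHom_rel ℂ (Rel.etaM_etaP (Q := Q))

theorem etaP_mul_del : etaP Q * del Q = Q.q ^ 2 • (del Q * etaP Q) := by
  simpa [del, etaP, gen] using RingQuot.mkAlgHom_rel ℂ (Rel.etaP_del (Q := Q))

theorem etaM_mul_del : etaM Q * del Q = Q.q ^ 2 • (del Q * etaM Q) := by
  simpa [del, etaM, gen] using RingQuot.mkAlgHom_rel ℂ (Rel.etaM_del (Q := Q))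

theorem del_pow : del Q ^ Q.p = 1 := by
  simpa [del, gen] using RingQuot.mkAlgHom_rel ℂ (Rel.del_pow (Q := Q))

theorem etaP_pow : etaP Q ^ Q.p = 0 := by
  simpa [etaP, gen] using RingQuot.mkAlgHom_rel ℂ (Rel.etaP_pow (Q := Q))

theorem etaM_pow : etaM Q ^ Q.p = 0 := by
  simpa [etaM, gen] using RingQuot.mkAlgHom_rel ℂ (Rel.etaM_pow (Q := Q))

theorem delInv_mul_del : delInv Q * del Q = 1 := by
  rw [delInv, ← pow_succ, Nat.sub_add_cancel Q.one_lt_p.le, del_pow]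

theorem del_mul_delInv : del Q * delInv Q = 1 := by
  rw [delInv, ← pow_succ', Nat.sub_add_cancel Q.one_lt_p.le, del_pow]

theorem delInv_mul_etaP : delInv Q * etaP Q = Q.q ^ 2 • (etaP Q * delInv Q) := by
  have h : delInv Q * (etaP Q * del Q) * delInv Q
      = delInv Q * (Q.q ^ 2 • (del Q * etaP Q)) * delInv Q := by rw [etaP_mul_del]
  rw [mul_assoc, mul_assoc, del_mul_delInv, mul_one, mul_smul_comm, ← mul_assoc, delInv_mul_del,
    one_mul, smul_mul_assoc] at h
  exact h

theorem delInv_mul_etaM : delInv Q * etaM Q = Q.q ^ 2 • (etaM Q * delInv Q) := by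
  have h : delInv Q * (etaM Q * del Q) * delInv Q
      = delInv Q * (Q.q ^ 2 • (del Q * etaM Q)) * delInv Q := by rw [etaM_mul_del]
  rw [mul_assoc, mul_assoc, del_mul_delInv, mul_one, mul_smul_comm, ← mul_assoc, delInv_mul_del,
    one_mul, smul_mul_assoc] at h
  exact h

/-- Algebra homomorphisms out of `A(E(1,1|p))` from images of the generators satisfying the
relations. -/
def Ared.lift {B : Type*} [Ring B] [Algebra ℂ B] (eP eM d : B)
    (h1 : eM * eP = Q.q ^ 2 • (eP * eM)) (h2 : eP * d = Q.q ^ 2 • (d * eP))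
    (h3 : eM * d = Q.q ^ 2 • (d * eM)) (h4 : d ^ Q.p = 1) (h5 : eP ^ Q.p = 0)
    (h6 : eM ^ Q.p = 0) : Ared Q →ₐ[ℂ] B :=
  RingQuot.liftAlgHom ℂ
    ⟨FreeAlgebra.lift ℂ (fun x : Gen => match x with
      | Gen.etaP => eP
      | Gen.etaM => eM
      | Gen.del => d), by
      intro x y h
      cases h <;> simp [h1, h2, h3, h4, h5, h6]⟩

/-! ### The `q`-binomial theorem at a root of unity -/

/-- Gaussian binomial coefficients. -/
def gauss (w : ℂ) : ℕ → ℕ → ℂ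
  | 0, 0 => 1
  | 0, _ + 1 => 0
  | n + 1, 0 => gauss w n 0
  | n + 1, k + 1 => gauss w n k + w ^ (k + 1) * gauss w n (k + 1)

theorem gauss_eq_zero_of_lt (w : ℂ) : ∀ n k, n < k → gauss w n k = 0
  | 0, k + 1, _ => rfl
  | n + 1, k + 1, h => by
    rw [gauss, gauss_eq_zero_of_lt w n k (by omega), gauss_eq_zero_of_lt w n (k + 1) (by omega)]
    simp

theorem gauss_absorb (w : ℂ) : ∀ n k,
    (1 - w ^ (k + 1)) * gauss w (n + 1) (k + 1) = (1 - w ^ (n + 1)) * gauss w n k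
  | 0, 0 => by simp [gauss]
  | 0, k + 1 => by simp [gauss]
  | n + 1, 0 => by
    have h := gauss_absorb w n 0
    have h0 : gauss w (n + 1) 0 = gauss w n 0 := rfl
    have h1 : gauss w (n + 1 + 1) (0 + 1)
        = gauss w (n + 1) 0 + w ^ (0 + 1) * gauss w (n + 1) (0 + 1) := rfl
    rw [h1, h0]
    linear_combination w * h
  | n + 1, k + 1 => by
    have h := gauss_absorb w n k
    have h' := gauss_absorb w n (k + 1)
    have e : gauss w (n + 1) (k + 1) = gauss w n k + w ^ (k + 1) * gauss w n (k + 1) := rfl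
    rw [gauss]
    linear_combination w ^ (k + 1 + 1) * h' + w * h - w * (1 - w ^ (n + 1)) * e

theorem add_pow_gauss {B : Type*} [Ring B] [Algebra ℂ B] (w : ℂ) (X Y : B)
    (h : Y * X = w • (X * Y)) (n : ℕ) :
    (X + Y) ^ n = ∑ k ∈ Finset.range (n + 1), gauss w n k • (X ^ k * Y ^ (n - k)) := by
  have hk : ∀ k, Y * X ^ k = w ^ k • (X ^ k * Y) := by
    intro k
    induction k with
    | zero => simp
    | succ k ih =>
      rw [pow_succ, ← mul_assoc, ih, smul_mul_assoc, mul_assoc, h, mul_smul_comm, smul_smul,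
        mul_assoc, pow_succ w]
  induction n with
  | zero => simp [gauss]
  | succ n ih =>
    rw [pow_succ', ih, add_mul, Finset.mul_sum, Finset.mul_sum, Finset.sum_range_succ' _ (n + 1)]
    have hY : ∑ k ∈ Finset.range (n + 1), Y * gauss w n k • (X ^ k * Y ^ (n - k))
        = ∑ k ∈ Finset.range (n + 1 + 1), (w ^ k * gauss w n k) • (X ^ k * Y ^ (n + 1 - k)) := by
      rw [Finset.sum_range_succ _ (n + 1), gauss_eq_zero_of_lt w n (n + 1) (by omega), mul_zero,
        zero_smul, add_zero]
      refine Finset.sum_congr rfl fun k hk' => ?_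
      have : n + 1 - k = (n - k) + 1 := by have := Finset.mem_range.1 hk'; omega
      rw [this, mul_smul_comm, ← mul_assoc, hk, smul_mul_assoc, smul_smul, mul_assoc, pow_succ',
        mul_comm]
    rw [hY, Finset.sum_range_succ' _ (n + 1), ← add_assoc, ← Finset.sum_add_distrib]
    congr 1
    · refine Finset.sum_congr rfl fun k _ => ?_
      rw [gauss, add_smul, mul_smul_comm, ← mul_assoc, ← pow_succ', Nat.add_sub_add_right]
    · simp [gauss]

theorem add_pow_eq_zero {B : Type*} [Ring B] [Algebra ℂ B] {w : ℂ} {p : ℕ} (hp : 0 < p)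
    (hw : IsPrimitiveRoot w p) {X Y : B} (h : Y * X = w • (X * Y)) (hX : X ^ p = 0)
    (hY : Y ^ p = 0) : (X + Y) ^ p = 0 := by
  rw [add_pow_gauss w X Y h]
  refine Finset.sum_eq_zero fun k hk => ?_
  rcases Nat.eq_zero_or_pos k with rfl | hk0
  · simp [hY]
  rcases (Nat.lt_succ_iff.1 (Finset.mem_range.1 hk)).eq_or_lt with rfl | hkp
  · simp [hX]
  · obtain ⟨j, rfl⟩ : ∃ j, k = j + 1 := ⟨k - 1, by omega⟩
    obtain ⟨n, rfl⟩ : ∃ n, p = n + 1 := ⟨p - 1, by omega⟩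
    have h1 := gauss_absorb w n j
    rw [hw.pow_eq_one, sub_self, zero_mul] at h1
    have h2 : 1 - w ^ (j + 1) ≠ 0 := sub_ne_zero.2 (hw.pow_ne_one_of_pos_of_lt (by omega) hkp).symm
    rw [(mul_eq_zero.1 h1).resolve_left h2, zero_smul]

theorem prim_sq : IsPrimitiveRoot (Q.q ^ 2) Q.p :=
  Q.prim.pow_of_coprime 2 (Nat.coprime_two_left.2 Q.odd_p)

theorem prim_sq_inv : IsPrimitiveRoot (Q.q ^ 2)⁻¹ Q.p := (prim_sq Q).inv

/-! ### The comultiplication of the reduced quantum group -/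

/-- `Δ(η₊) = η₊ ⊗ 1 + δ ⊗ η₊`, `Δ(η₋) = η₋ ⊗ 1 + δ⁻¹ ⊗ η₋`, `Δ(δ) = δ ⊗ δ`. -/
def comulRed : Ared Q →ₐ[ℂ] Ared Q ⊗[ℂ] Ared Q :=
  Ared.lift Q (B := Ared Q ⊗[ℂ] Ared Q) (etaP Q ⊗ₜ[ℂ] 1 + del Q ⊗ₜ[ℂ] etaP Q)
    (etaM Q ⊗ₜ[ℂ] 1 + delInv Q ⊗ₜ[ℂ] etaM Q) (del Q ⊗ₜ[ℂ] del Q)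
    (by
      have hq := Q.q_ne_zero
      simp only [add_mul, mul_add, Algebra.TensorProduct.tmul_mul_tmul, mul_one, one_mul,
        etaM_mul_etaP, etaM_mul_del, delInv_mul_etaP, del_mul_delInv, delInv_mul_del,
        TensorProduct.smul_tmul', TensorProduct.tmul_smul, smul_add]
      abel)
    (by
      simp only [add_mul, mul_add, Algebra.TensorProduct.tmul_mul_tmul, mul_one, one_mul,
        etaP_mul_del, TensorProduct.smul_tmul', TensorProduct.tmul_smul, smul_add])
    (by
      simp only [add_mul, mul_add, Algebra.TensorProduct.tmul_mul_tmul, mul_one, one_mul,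
        etaM_mul_del, delInv_mul_del, del_mul_delInv, TensorProduct.smul_tmul',
        TensorProduct.tmul_smul, smul_add])
    (by rw [Algebra.TensorProduct.tmul_pow, del_pow, Algebra.TensorProduct.one_def])
    (by
      refine add_pow_eq_zero (B := Ared Q ⊗[ℂ] Ared Q) (X := etaP Q ⊗ₜ[ℂ] 1)
        (Y := del Q ⊗ₜ[ℂ] etaP Q) (by have := Q.one_lt_p; omega) (prim_sq_inv Q) ?_ ?_ ?_
      · simp only [Algebra.TensorProduct.tmul_mul_tmul, mul_one, one_mul, etaP_mul_del,
          TensorProduct.smul_tmul', smul_smul]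
        rw [inv_mul_cancel₀ (pow_ne_zero 2 Q.q_ne_zero), one_smul]
      · rw [Algebra.TensorProduct.tmul_pow, etaP_pow, TensorProduct.zero_tmul]
      · rw [Algebra.TensorProduct.tmul_pow, etaP_pow, TensorProduct.tmul_zero])
    (by
      refine add_pow_eq_zero (B := Ared Q ⊗[ℂ] Ared Q) (X := etaM Q ⊗ₜ[ℂ] 1)
        (Y := delInv Q ⊗ₜ[ℂ] etaM Q) (by have := Q.one_lt_p; omega) (prim_sq Q) ?_ ?_ ?_
      · simp only [Algebra.TensorProduct.tmul_mul_tmul, mul_one, one_mul, delInv_mul_etaM,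
          TensorProduct.smul_tmul']
      · rw [Algebra.TensorProduct.tmul_pow, etaM_pow, TensorProduct.zero_tmul]
      · rw [Algebra.TensorProduct.tmul_pow, etaM_pow, TensorProduct.tmul_zero])

/-! ### Smooth functions -/

/-- The algebra `C^∞(V)` of smooth complex functions on a real normed space. -/
def Smooth (V : Type*) [NormedAddCommGroup V] [NormedSpace ℝ V] : Subalgebra ℂ (V → ℂ) where
  carrier := {f | ContDiff ℝ ∞ f}
  mul_mem' {f g} (hf : ContDiff ℝ ∞ f) (hg : ContDiff ℝ ∞ g) := hf.mul hg
  add_mem' {f g} (hf : ContDiff ℝ ∞ f) (hg : ContDiff ℝ ∞ g) := hf.add hg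
  algebraMap_mem' c := (contDiff_const : ContDiff ℝ ∞ fun _ : V => c)

theorem Smooth.contDiff {V : Type*} [NormedAddCommGroup V] [NormedSpace ℝ V] (f : Smooth V) :
    ContDiff ℝ ∞ (f : V → ℂ) := f.2

/-- The plane `R²` with coordinates `z = (z₊, z₋)`. -/
abbrev R2 : Type := ℝ × ℝ

/-- The derivative of a smooth function in the direction `v`. -/
def dir {V : Type*} [NormedAddCommGroup V] [NormedSpace ℝ V] (v : V) :
    Smooth V →ₗ[ℂ] Smooth V where
  toFun f := ⟨fun z => fderiv ℝ (f : V → ℂ) z v,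
    (Smooth.contDiff f).fderiv_right (m := ∞) (by simp) |>.clm_apply contDiff_const⟩
  map_add' f g := by
    have hf : ContDiff ℝ ∞ (f : V → ℂ) := f.2
    have hg : ContDiff ℝ ∞ (g : V → ℂ) := g.2
    ext z
    exact congrArg (· v) (fderiv_add (hf.differentiable (by simp) z)
      (hg.differentiable (by simp) z))
  map_smul' c f := by
    have hf : ContDiff ℝ ∞ (f : V → ℂ) := f.2
    ext z
    exact congrArg (· v) (fderiv_const_smul (hf.differentiable (by simp) z) c)

/-- `∂/∂z₊` and `∂/∂z₋`. -/
def dP : Smooth R2 →ₗ[ℂ] Smooth R2 := dir (1, 0)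
def dM : Smooth R2 →ₗ[ℂ] Smooth R2 := dir (0, 1)

/-- `f ↦ f(Z)`, with `Z = z ⊗ 1 + 1 ⊗ z`: the function `(z, w) ↦ f(z + w)`. -/
def pullAdd : Smooth R2 →ₗ[ℂ] Smooth (R2 × R2) where
  toFun f := ⟨fun x => (f : R2 → ℂ) (x.1 + x.2),
    (Smooth.contDiff f).comp (contDiff_fst.add contDiff_snd)⟩
  map_add' _ _ := rfl
  map_smul' _ _ := rfl

/-- `g ↦ g(0, ·)`: evaluation at the unit element in the first variable. -/
def evalFst : Smooth (R2 × R2) →ₗ[ℂ] Smooth R2 where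
  toFun g := ⟨fun w => (g : R2 × R2 → ℂ) (0, w),
    (Smooth.contDiff g).comp (contDiff_const.prodMk contDiff_id)⟩
  map_add' _ _ := rfl
  map_smul' _ _ := rfl

/-! ### The quantum Poincaré group at a root of unity -/

/-- `A(E_q(1,1)) = A(E(1,1|p)) × C^∞(R²)`, with `z±` central. -/
abbrev AE : Type := Ared Q ⊗[ℂ] Smooth R2

/-- The target of the comultiplication of `A(E_q(1,1))`: the tensor square, in which
`C^∞(R²) ⊗ C^∞(R²)` is completed to `C^∞(R² × R²)`. -/
abbrev AE2 : Type := (Ared Q ⊗[ℂ] Ared Q) ⊗[ℂ] Smooth (R2 × R2)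

/-- `B₊ = (-1)^{(p+1)/2} ∑_{n=1}^{p-1} q^{n²} / ([p-n]! [n]!) η₊^{p-n} δ^n ⊗ η₊^n`. -/
def BP : Ared Q ⊗[ℂ] Ared Q :=
  (-1 : ℂ) ^ ((Q.p + 1) / 2) • ∑ n ∈ Finset.Ico 1 Q.p,
    (Q.q ^ (n ^ 2) / (Q.qFact (Q.p - n) * Q.qFact n)) •
      ((etaP Q ^ (Q.p - n) * del Q ^ n) ⊗ₜ[ℂ] (etaP Q ^ n))

/-- `B₋ = (-1)^{(p+1)/2} ∑_{n=1}^{p-1} q^{-n²} / ([p-n]! [n]!) η₋^{p-n} δ^{-n} ⊗ η₋^n`. -/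
def BM : Ared Q ⊗[ℂ] Ared Q :=
  (-1 : ℂ) ^ ((Q.p + 1) / 2) • ∑ n ∈ Finset.Ico 1 Q.p,
    ((Q.q⁻¹) ^ (n ^ 2) / (Q.qFact (Q.p - n) * Q.qFact n)) •
      ((etaM Q ^ (Q.p - n) * delInv Q ^ n) ⊗ₜ[ℂ] (etaM Q ^ n))

/-- `Δ(f(z)) = f(Z) + ∂₊f(Z) B₊ + ∂₋f(Z) B₋ + ∂₊∂₋f(Z) B₊B₋`. -/
def comulFun : Smooth R2 →ₗ[ℂ] AE2 Q :=
  TensorProduct.mk ℂ _ _ 1 ∘ₗ pullAdd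
    + TensorProduct.mk ℂ _ _ (BP Q) ∘ₗ pullAdd ∘ₗ dP
    + TensorProduct.mk ℂ _ _ (BM Q) ∘ₗ pullAdd ∘ₗ dM
    + TensorProduct.mk ℂ _ _ (BP Q * BM Q) ∘ₗ pullAdd ∘ₗ dP ∘ₗ dM

/-- The comultiplication of `A(E_q(1,1))`: `Δ(a f) = Δ(a) Δ(f)`. -/
def comul : AE Q →ₗ[ℂ] AE2 Q :=
  TensorProduct.lift ((LinearMap.mul ℂ (AE2 Q)).compl₁₂
    (Algebra.TensorProduct.includeLeft.toLinearMap ∘ₗ (comulRed Q).toLinearMap) (comulFun Q))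

/-! ### The pairing with `p±` and the right regular representation -/

/-- `a ↦ !![⟨κ⁻¹, a⟩, ⟨p₊, a⟩; 0, ⟨κ, a⟩]`. This is multiplicative because
`Δ(κ) = κ ⊗ κ` and `Δ(p₊) = p₊ ⊗ κ + κ⁻¹ ⊗ p₊`; the values on generators are
`⟨κ^{±1}, δ⟩ = q^{±1}`, `⟨p₊, η₊⟩ = i q^{1/2}`, and `0` otherwise. -/
def pairMatP : Ared Q →ₐ[ℂ] Matrix (Fin 2) (Fin 2) ℂ :=
  Ared.lift Q !![0, Complex.I * Q.qh; 0, 0] 0 !![Q.q⁻¹, 0; 0, Q.q]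
    (by simp)
    (by
      have hq := Q.q_ne_zero
      ext i j
      fin_cases i <;> fin_cases j <;> simp [Matrix.mul_apply, Fin.sum_univ_two]
      field_simp)
    (by simp)
    (by
      have h : (!![Q.q⁻¹, 0; 0, Q.q] : Matrix (Fin 2) (Fin 2) ℂ)
          = Matrix.diagonal ![Q.q⁻¹, Q.q] := by
        ext i j; fin_cases i <;> fin_cases j <;> simp
      rw [h, Matrix.diagonal_pow, ← Matrix.diagonal_one]
      congr 1
      ext i; fin_cases i <;> simp [Q.prim.pow_eq_one])
    (by
      refine pow_eq_zero_of_le (m := 2) Q.one_lt_p ?_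
      ext i j; fin_cases i <;> fin_cases j <;> simp [pow_two, Matrix.mul_apply])
    (by simp [NeZero.ne])

/-- `a ↦ !![⟨κ⁻¹, a⟩, ⟨p₋, a⟩; 0, ⟨κ, a⟩]`, with `⟨p₋, η₋⟩ = i q^{-1/2}`. -/
def pairMatM : Ared Q →ₐ[ℂ] Matrix (Fin 2) (Fin 2) ℂ :=
  Ared.lift Q 0 !![0, Complex.I * Q.qh⁻¹; 0, 0] !![Q.q⁻¹, 0; 0, Q.q]
    (by simp)
    (by simp)
    (by
      have hq := Q.q_ne_zero
      ext i j
      fin_cases i <;> fin_cases j <;> simp [Matrix.mul_apply, Fin.sum_univ_two]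
      field_simp)
    (by
      have h : (!![Q.q⁻¹, 0; 0, Q.q] : Matrix (Fin 2) (Fin 2) ℂ)
          = Matrix.diagonal ![Q.q⁻¹, Q.q] := by
        ext i j; fin_cases i <;> fin_cases j <;> simp
      rw [h, Matrix.diagonal_pow, ← Matrix.diagonal_one]
      congr 1
      ext i; fin_cases i <;> simp [Q.prim.pow_eq_one])
    (by simp [NeZero.ne])
    (by
      refine pow_eq_zero_of_le (m := 2) Q.one_lt_p ?_
      ext i j; fin_cases i <;> fin_cases j <;> simp [pow_two, Matrix.mul_apply])

/-- The functionals `⟨p±, ·⟩` on `A(E(1,1|p))`. -/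
def pairP : Ared Q →ₗ[ℂ] ℂ := Matrix.entryLinearMap ℂ ℂ 0 1 ∘ₗ (pairMatP Q).toLinearMap
def pairM : Ared Q →ₗ[ℂ] ℂ := Matrix.entryLinearMap ℂ ℂ 0 1 ∘ₗ (pairMatM Q).toLinearMap

/-- `φ ⊗ id`, where the functional `φ` on `A(E(1,1|p))` is extended to `A(E_q(1,1))` by
`⟨φ, a f⟩ = ⟨φ, a⟩ f(0)`. -/
def slice (φ : Ared Q →ₗ[ℂ] ℂ) : AE2 Q →ₗ[ℂ] AE Q :=
  TensorProduct.map ((TensorProduct.lid ℂ (Ared Q)).toLinearMap ∘ₗ φ.rTensor (Ared Q)) evalFst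

/-- `R(p±) F = F ⋄ p± = (p± ⊗ id) Δ(F)`. -/
def RP : Module.End ℂ (AE Q) := slice Q (pairP Q) ∘ₗ comul Q
def RM : Module.End ℂ (AE Q) := slice Q (pairM Q) ∘ₗ comul Q

/-! ### The cyclic representation `L^λ` -/

/-- The algebra `A(SO(1,1|p))` of polynomials in `δ`, `δ^p = 1`. -/
abbrev ASO : Type := AddMonoidAlgebra ℂ (ZMod Q.p)

/-- The generator `δ` of `A(SO(1,1|p))`. -/
def delta : ASO Q := AddMonoidAlgebra.single 1 1

/-- The basis `(δ^m)`, `m` modulo `p`. -/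
def basisSO : Module.Basis (ZMod Q.p) ℂ (ASO Q) := AddMonoidAlgebra.basis (ZMod Q.p) ℂ

/-- `L(p₊) δ^m = λ₊ δ^{m+1}`. -/
def LP (l : ℂ) : Module.End ℂ (ASO Q) :=
  (basisSO Q).constr ℂ fun m => l • basisSO Q (m + 1)

/-- `L(p₋) δ^m = λ₋ δ^{m-1}`. -/
def LM (l : ℂ) : Module.End ℂ (ASO Q) :=
  (basisSO Q).constr ℂ fun m => l • basisSO Q (m - 1)

/-- `L(κ) δ^m = q^m δ^m`. -/
def LK : Module.End ℂ (ASO Q) :=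
  (basisSO Q).constr ℂ fun m => Q.q ^ m.val • basisSO Q m

/-- `L(ε±)`, with `ε± = - q^{∓1/2} p± κ⁻¹` and `κ⁻¹ = κ^{p-1}`. -/
def LepsP (l : ℂ) : Module.End ℂ (ASO Q) := -(Q.qh⁻¹ • (LP Q l * LK Q ^ (Q.p - 1)))
def LepsM (l : ℂ) : Module.End ℂ (ASO Q) := -(Q.qh • (LM Q l * LK Q ^ (Q.p - 1)))

/-! ### The representation `T^λ` and its matrix elements -/

/-- The cut off `q`-exponentials `e_±^x = ∑_{m=0}^{p-1} q^{±m(m-1)/2} / [m]! x^m`. -/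
def cutExpP {B : Type*} [Ring B] [Algebra ℂ B] (x : B) : B :=
  ∑ m ∈ Finset.range Q.p, (Q.q ^ (m * (m - 1) / 2) / Q.qFact m) • x ^ m
def cutExpM {B : Type*} [Ring B] [Algebra ℂ B] (x : B) : B :=
  ∑ m ∈ Finset.range Q.p, ((Q.q⁻¹) ^ (m * (m - 1) / 2) / Q.qFact m) • x ^ m

/-- The element `M ⊗ F` of `Lin A(SO(1,1|p)) ⊗ A(E_q(1,1))`, as an operator on
`A(SO(1,1|p)) ⊗ A(E_q(1,1))`. -/
def tens (M : Module.End ℂ (ASO Q)) (F : AE Q) : Module.End ℂ (ASO Q ⊗[ℂ] AE Q) :=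
  TensorProduct.map M (LinearMap.mulLeft ℂ F)

/-- The matrix of an operator on `A(SO(1,1|p))` in the basis `(δ^m)`. -/
def mat (M : Module.End ℂ (ASO Q)) : Matrix (ZMod Q.p) (ZMod Q.p) ℂ :=
  LinearMap.toMatrix (basisSO Q) (basisSO Q) M

section
attribute [local instance] Matrix.linftyOpNormedRing Matrix.linftyOpNormedAlgebra

theorem contDiff_exp_matrix {ι : Type} [Fintype ι] [DecidableEq ι] (M N : Matrix ι ι ℂ) (i j : ι) :
    ContDiff ℝ ∞ fun z : R2 =>
      (NormedSpace.exp (-((Complex.I * (z.1 : ℂ)) • M) - (Complex.I * (z.2 : ℂ)) • N)) i j := by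
  have h1 : ContDiff ℝ ∞ fun x : Matrix ι ι ℂ => NormedSpace.exp x :=
    AnalyticOnNhd.contDiff fun x _ => NormedSpace.exp_analytic x
  have h2 : ContDiff ℝ ∞ fun A : Matrix ι ι ℂ => A i j :=
    (LinearMap.toContinuousLinearMap
      (Matrix.entryLinearMap ℝ ℂ i j : Matrix ι ι ℂ →ₗ[ℝ] ℂ)).contDiff
  have h3 : ∀ L : R2 →L[ℝ] ℝ, ∀ M : Matrix ι ι ℂ,
      ContDiff ℝ ∞ fun z : R2 => (Complex.I * ((L z : ℝ) : ℂ)) • M := fun L M =>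
    (contDiff_const.mul (Complex.ofRealCLM.contDiff.comp L.contDiff)).smul contDiff_const
  exact h2.comp (h1.comp
    ((h3 (ContinuousLinearMap.fst ℝ ℝ ℝ) M).neg.sub (h3 (ContinuousLinearMap.snd ℝ ℝ ℝ) N)))
end

/-- The `(i, j)` entry of `exp(-i z₊ M - i z₋ N)`, as a smooth function of `z`. -/
def expEntry (M N : Matrix (ZMod Q.p) (ZMod Q.p) ℂ) (i j : ZMod Q.p) : Smooth R2 :=
  ⟨fun z => (NormedSpace.exp
    (-((Complex.I * (z.1 : ℂ)) • M) - (Complex.I * (z.2 : ℂ)) • N)) i j,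
    contDiff_exp_matrix M N i j⟩

/-- The operator `exp(-i M ⊗ z₊ - i N ⊗ z₋)`. -/
def expOp (M N : Module.End ℂ (ASO Q)) : Module.End ℂ (ASO Q ⊗[ℂ] AE Q) :=
  ∑ i, ∑ j, tens Q
    (LinearMap.toMatrix (basisSO Q) (basisSO Q) |>.symm (Matrix.single i j 1))
    (1 ⊗ₜ[ℂ] expEntry Q (mat Q M) (mat Q N) i j)

/-- `D(L(κ), δ) = (1/p) ∑_{m,k=0}^{p-1} q^{-mk} L(κ)^m ⊗ δ^k`. -/
def Dop : Module.End ℂ (ASO Q ⊗[ℂ] AE Q) :=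
  (1 / (Q.p : ℂ)) • ∑ m ∈ Finset.range Q.p, ∑ k ∈ Finset.range Q.p,
    (Q.q⁻¹) ^ (m * k) • tens Q (LK Q ^ m) ((del Q ^ k) ⊗ₜ[ℂ] 1)

/-- `T^λ a = e^{-i L(P₊) ⊗ z₊ - i L(P₋) ⊗ z₋} e_+^{i L(ε₊) ⊗ η₊} e_-^{i L(ε₋) ⊗ η₋} D(L(κ), δ) (a ⊗ 1)`,
with `P± = p±^p`. -/
def T (lP lM : ℂ) : ASO Q →ₗ[ℂ] ASO Q ⊗[ℂ] AE Q :=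
  (expOp Q (LP Q lP ^ Q.p) (LM Q lM ^ Q.p)
      * cutExpP Q (Complex.I • tens Q (LepsP Q lP) (etaP Q ⊗ₜ[ℂ] 1))
      * cutExpM Q (Complex.I • tens Q (LepsM Q lM) (etaM Q ⊗ₜ[ℂ] 1))
      * Dop Q) ∘ₗ (TensorProduct.mk ℂ (ASO Q) (AE Q)).flip 1

/-- The involution of `A(SO(1,1|p))`: antilinear, with `δ* = δ`. -/
def starSO (a : ASO Q) : ASO Q := ∑ m, AddMonoidAlgebra.single m (star (a.coeff m))

/-- The invariant integral of `A(SO(1,1|p))`: `I_S(δ^m) = 1` if `p ∣ m`, and `0` otherwise. -/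
def intSO : ASO Q →ₗ[ℂ] ℂ := (basisSO Q).coord 0

/-- The Hermitian form `(a, b)_S = I_S(a* b)`, as a linear functional of `b`. -/
def formSO (a : ASO Q) : ASO Q →ₗ[ℂ] ℂ := intSO Q ∘ₗ LinearMap.mulLeft ℂ (starSO Q a)

/-- `{a ⊗ 1, b ⊗ G}_S = (a, b)_S G`, as a linear map of `b ⊗ G`. -/
def formExt (a : ASO Q) : ASO Q ⊗[ℂ] AE Q →ₗ[ℂ] AE Q :=
  (TensorProduct.lid ℂ (AE Q)).toLinearMap ∘ₗ (formSO Q a).rTensor (AE Q)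

/-- The matrix elements `D^λ_{mn} = {δ^{p-m} ⊗ 1, T^λ δ^n}_S`, for `0 ≤ m, n ≤ p - 1`. -/
def D (lP lM : ℂ) (m n : ℕ) : AE Q :=
  formExt Q (delta Q ^ (Q.p - m)) (T Q lP lM (delta Q ^ n))

end QPoincare

end

/-!
Since `L(κ)` fixes `δ⁰`, the factor `D(L(κ), δ)` acts trivially on `δ⁰ ⊗ 1`, and since
`L(P±) = λ±^p` is a scalar, the exponential contributes only the plane wave
`E = exp(-i λ₊^p z₊ - i λ₋^p z₋)`. Hence `D^λ_{m0}` is the sum over `k, n < p` with `k - n ≡ m` of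
`c_{k,n} η₊^k η₋^n E`, where
`c_{k,n} = (-i q^{-1/2} λ₊)^k (-i q^{1/2} λ₋)^n q^{nk} / ([k]! [n]!)` (`D_zero`).

The pairing `⟨p±, ·⟩` is the corner of a representation by upper triangular `2 × 2` matrices, so
`(p± ⊗ id) Δ` is the corner of an algebra homomorphism into `2 × 2` matrices over `A(E(1,1|p))`
(`sliceMat`), which can be evaluated factor by factor (`slice_comul_tmul`). It kills the `B` of the
opposite sign and leaves the single summand `n = p - 1` of the other one. Therefore `R(p₊)` sends
`η₊^k η₋^n E` to a multiple of `η₊^{k-1} η₋^n E` when `k > 0`, through the `q`-derivative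
`[k] η₊^{k-1}`, and to a multiple of `η₊^{p-1} η₋^n E` when `k = 0`, through `∂₊E` and `B₊`
(`RP_tmul_succ`, `RP_tmul_zero`); `R(p₋)` does the same with the exponent of `η₋`.

In both cases the scalar is exactly the one that carries `c_{k,n}` to `λ±` times the coefficient of
the image (`RP_coef_succ`, `RP_coef_zero` and their analogues); for the top powers this uses
`(q^{1/2})^p = -1` and the sign of `B±`. So `R(p±)` is a cyclic shift of the summation index, which
moves `m` by `∓1` modulo `p` (`RP_D`, `RM_D`).
-/

noncomputable section

namespace QPoincare

variable (Q : RootParam)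

/-! ### q-numbers at a root of unity -/

namespace RootParam

theorem q_sub_inv_ne_zero : Q.q - Q.q⁻¹ ≠ 0 := by
  intro h
  have h1 : Q.q ^ 2 = 1 := by
    rw [pow_two]
    nth_rewrite 2 [sub_eq_zero.1 h]
    exact mul_inv_cancel₀ Q.q_ne_zero
  have h2 := Nat.le_of_dvd two_pos (Q.prim.dvd_of_pow_eq_one 2 h1)
  obtain ⟨k, hk⟩ := Q.odd_p
  have := Q.one_lt_p
  omega

theorem qNum_zero : Q.qNum 0 = 0 := by simp [qNum]

theorem qNum_one : Q.qNum 1 = 1 := by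
  simp [qNum, div_self Q.q_sub_inv_ne_zero]

/-- One of two recursions for `[k]`, exchanged by `q ↦ q⁻¹`. They match the two orders in which
`q` and `q⁻¹` stand on the diagonal in `upper_pow`. -/
theorem qNum_succ (k : ℕ) : Q.qNum (k + 1) = Q.q * Q.qNum k + Q.q⁻¹ ^ k := by
  have h := Q.q_sub_inv_ne_zero
  have hq := Q.q_ne_zero
  rw [qNum, qNum, div_eq_iff h, add_mul, mul_assoc, div_mul_cancel₀ _ h, pow_succ, pow_succ]
  field_simp
  ring

theorem qNum_succ_inv (k : ℕ) : Q.qNum (k + 1) = Q.q⁻¹ * Q.qNum k + Q.q ^ k := by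
  have h := Q.q_sub_inv_ne_zero
  have hq := Q.q_ne_zero
  rw [qNum, qNum, div_eq_iff h, add_mul, mul_assoc, div_mul_cancel₀ _ h, pow_succ, pow_succ]
  field_simp
  ring

theorem qNum_ne_zero {n : ℕ} (h0 : 0 < n) (hn : n < Q.p) : Q.qNum n ≠ 0 := by
  rw [qNum]
  refine div_ne_zero (fun h => ?_) Q.q_sub_inv_ne_zero
  have h1 : (Q.q ^ 2) ^ n = 1 := by
    rw [← pow_mul, mul_comm, pow_mul, pow_two]
    nth_rewrite 2 [sub_eq_zero.1 h]
    rw [← mul_pow, mul_inv_cancel₀ Q.q_ne_zero, one_pow]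
  exact (prim_sq Q).pow_ne_one_of_pos_of_lt h0.ne' hn h1

theorem qFact_zero : Q.qFact 0 = 1 := by simp [qFact]

theorem qFact_succ (n : ℕ) : Q.qFact (n + 1) = Q.qFact n * Q.qNum (n + 1) := by
  rw [qFact, Finset.prod_Icc_succ_top (by omega), qFact]

theorem qh_ne_zero : Q.qh ≠ 0 := by
  rintro h
  have := Q.qh_sq
  rw [h] at this
  exact Q.q_ne_zero (by rw [← this]; simp)

/-- The sign in `(q^{1/2})^p = -1` enters the closing step of each cycle through this value. -/
theorem qh_pow_pred : Q.qh ^ (Q.p - 1) = -Q.qh⁻¹ := by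
  have h : Q.qh ^ (Q.p - 1) * Q.qh = -1 := by
    rw [← pow_succ, Nat.sub_add_cancel Q.one_lt_p.le, Q.qh_pow]
  rw [eq_neg_iff_add_eq_zero]
  have := Q.qh_ne_zero
  field_simp
  rw [h]; ring

theorem q_pow_pred : Q.q ^ (Q.p - 1) = Q.q⁻¹ := by
  apply eq_inv_of_mul_eq_one_left
  rw [← pow_succ, Nat.sub_add_cancel Q.one_lt_p.le, Q.prim.pow_eq_one]

end RootParam

/-! ### The matrix pairings on generators -/

section Lift
variable {B : Type*} [Ring B] [Algebra ℂ B] (eP eM d : B)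
    (h1 : eM * eP = Q.q ^ 2 • (eP * eM)) (h2 : eP * d = Q.q ^ 2 • (d * eP))
    (h3 : eM * d = Q.q ^ 2 • (d * eM)) (h4 : d ^ Q.p = 1) (h5 : eP ^ Q.p = 0)
    (h6 : eM ^ Q.p = 0)

theorem Ared.lift_etaP : Ared.lift Q eP eM d h1 h2 h3 h4 h5 h6 (etaP Q) = eP := by
  simp [Ared.lift, etaP, gen]

theorem Ared.lift_etaM : Ared.lift Q eP eM d h1 h2 h3 h4 h5 h6 (etaM Q) = eM := by
  simp [Ared.lift, etaM, gen]

theorem Ared.lift_del : Ared.lift Q eP eM d h1 h2 h3 h4 h5 h6 (del Q) = d := by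
  simp [Ared.lift, del, gen]

end Lift

theorem comulRed_etaP : comulRed Q (etaP Q) = etaP Q ⊗ₜ[ℂ] 1 + del Q ⊗ₜ[ℂ] etaP Q :=
  Ared.lift_etaP ..

theorem comulRed_etaM : comulRed Q (etaM Q) = etaM Q ⊗ₜ[ℂ] 1 + delInv Q ⊗ₜ[ℂ] etaM Q :=
  Ared.lift_etaM ..

theorem pairMatP_etaP : pairMatP Q (etaP Q) = !![0, Complex.I * Q.qh; 0, 0] := Ared.lift_etaP ..
theorem pairMatP_etaM : pairMatP Q (etaM Q) = 0 := Ared.lift_etaM ..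
theorem pairMatP_del : pairMatP Q (del Q) = !![Q.q⁻¹, 0; 0, Q.q] := Ared.lift_del ..
theorem pairMatM_etaP : pairMatM Q (etaP Q) = 0 := Ared.lift_etaP ..
theorem pairMatM_etaM : pairMatM Q (etaM Q) = !![0, Complex.I * Q.qh⁻¹; 0, 0] := Ared.lift_etaM ..
theorem pairMatM_del : pairMatM Q (del Q) = !![Q.q⁻¹, 0; 0, Q.q] := Ared.lift_del ..

theorem diag_two_pow (a b : ℂ) (n : ℕ) :
    (!![a, 0; 0, b] : Matrix (Fin 2) (Fin 2) ℂ) ^ n = !![a ^ n, 0; 0, b ^ n] := by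
  induction n with
  | zero => ext i j; fin_cases i <;> fin_cases j <;> simp
  | succ n ih => rw [pow_succ, ih]; simp [pow_succ]

theorem delInv_diag : (!![Q.q⁻¹, 0; 0, Q.q] : Matrix (Fin 2) (Fin 2) ℂ) ^ (Q.p - 1)
    = !![Q.q, 0; 0, Q.q⁻¹] := by
  rw [diag_two_pow, inv_pow, Q.q_pow_pred, inv_inv]

theorem pairMatP_delInv : pairMatP Q (delInv Q) = !![Q.q, 0; 0, Q.q⁻¹] := by
  rw [delInv, map_pow, pairMatP_del, delInv_diag]

theorem pairMatM_delInv : pairMatM Q (delInv Q) = !![Q.q, 0; 0, Q.q⁻¹] := by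
  rw [delInv, map_pow, pairMatM_del, delInv_diag]

/-! ### Slicing the comultiplication -/

/-- The map `M ⊗ id` on `A(E(1,1|p)) ⊗ A(E(1,1|p))`, for a matrix representation `M` of the first
factor, with `M₂(ℂ) ⊗ A` identified with `M₂(A)`. -/
def sliceMat (M : Ared Q →ₐ[ℂ] Matrix (Fin 2) (Fin 2) ℂ) :
    Ared Q ⊗[ℂ] Ared Q →ₐ[ℂ] Matrix (Fin 2) (Fin 2) (Ared Q) :=
  (matrixEquivTensor (Fin 2) ℂ (Ared Q)).symm.toAlgHom.comp
    ((Algebra.TensorProduct.comm ℂ _ _).toAlgHom.comp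
      (Algebra.TensorProduct.map M (AlgHom.id ℂ (Ared Q))))

variable {Q}

theorem sliceMat_tmul (M : Ared Q →ₐ[ℂ] Matrix (Fin 2) (Fin 2) ℂ) (a b : Ared Q) :
    sliceMat Q M (a ⊗ₜ[ℂ] b) = (M a).map (· • b) := by
  ext i j
  simp [sliceMat, matrixEquivTensor_apply_symm, Algebra.smul_def, Algebra.commutes]

/-- Slicing with the corner entry of `M` is the same entry of `M ⊗ id`. -/
theorem lid_rTensor_entry (M : Ared Q →ₐ[ℂ] Matrix (Fin 2) (Fin 2) ℂ) (X : Ared Q ⊗[ℂ] Ared Q) :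
    TensorProduct.lid ℂ (Ared Q)
      ((Matrix.entryLinearMap ℂ ℂ 0 1 ∘ₗ M.toLinearMap).rTensor (Ared Q) X)
      = sliceMat Q M X 0 1 := by
  induction X with
  | zero => simp
  | add x y hx hy => simp only [map_add, hx, hy, Matrix.add_apply]
  | tmul a b => simp [sliceMat_tmul]

/-- On a product of `a` with a smooth function `E` that is an eigenvector of both derivatives and
restricts to itself, slicing the comultiplication reduces to the matrix `M ⊗ id`. -/
theorem slice_comul_tmul (M : Ared Q →ₐ[ℂ] Matrix (Fin 2) (Fin 2) ℂ) (a : Ared Q) {E : Smooth R2}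
    {cP cM : ℂ} (hP : dP E = cP • E) (hM : dM E = cM • E) (hE : evalFst (pullAdd E) = E) :
    slice Q (Matrix.entryLinearMap ℂ ℂ 0 1 ∘ₗ M.toLinearMap) (comul Q (a ⊗ₜ[ℂ] E))
      = (sliceMat Q M (comulRed Q a) * (1 + cP • sliceMat Q M (BP Q) + cM • sliceMat Q M (BM Q)
          + (cM * cP) • (sliceMat Q M (BP Q) * sliceMat Q M (BM Q)))) 0 1 ⊗ₜ[ℂ] E := by
  have h : comul Q (a ⊗ₜ[ℂ] E) = (comulRed Q a * (1 + cP • BP Q + cM • BM Q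
      + (cM * cP) • (BP Q * BM Q))) ⊗ₜ[ℂ] pullAdd E := by
    simp [comul, comulFun, hP, hM, mul_add, TensorProduct.add_tmul,
      TensorProduct.smul_tmul', smul_smul]
  rw [h, slice, TensorProduct.map_tmul, hE, LinearMap.comp_apply]
  rw [LinearEquiv.coe_coe, lid_rTensor_entry]
  simp only [map_mul, map_add, map_smul, map_one]

/-- Powers of an upper triangular matrix with diagonal `v x, u x` and a scalar corner: the corner
of the `k`-th power is a multiple of `x ^ (k - 1)`, by the recursion satisfied by `N`. -/
theorem upper_pow {B : Type*} [Semiring B] [Algebra ℂ B] (x : B) (u v c : ℂ) (N : ℕ → ℂ)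
    (h0 : N 0 = 0) (hN : ∀ k, N (k + 1) = u * N k + v ^ k) (k : ℕ) :
    (!![v • x, c • 1; 0, u • x] : Matrix (Fin 2) (Fin 2) B) ^ k
      = !![v ^ k • x ^ k, (c * N k) • x ^ (k - 1); 0, u ^ k • x ^ k] := by
  induction k with
  | zero =>
    ext i j
    fin_cases i <;> fin_cases j <;> simp [h0]
  | succ k ih =>
    rw [pow_succ, ih, Matrix.mul_fin_two]
    have hx : N k • (x ^ (k - 1) * x) = N k • x ^ k := by
      rcases k with _ | k
      · simp [h0]
      · rw [Nat.add_sub_cancel, pow_succ]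
    have h : (v ^ k • x ^ k) * (c • (1 : B)) + ((c * N k) • x ^ (k - 1)) * (u • x)
        = (c * N (k + 1)) • x ^ (k + 1 - 1) := by
      rw [smul_mul_smul_comm, smul_mul_smul_comm, mul_one, Nat.add_sub_cancel, hN,
        show c * N k * u = (c * u) * N k by ring, mul_smul (c * u), hx, smul_smul, ← add_smul]
      congr 1; ring
    rw [h]
    simp [pow_succ, smul_smul, mul_comm v, mul_comm u]

theorem diag_smul_pow {B : Type*} [Semiring B] [Algebra ℂ B] (x : B) (u v : ℂ) (k : ℕ) :
    (!![v • x, 0; 0, u • x] : Matrix (Fin 2) (Fin 2) B) ^ k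
      = !![v ^ k • x ^ k, 0; 0, u ^ k • x ^ k] := by
  induction k with
  | zero => ext i j; fin_cases i <;> fin_cases j <;> simp
  | succ k ih => rw [pow_succ, ih]; simp [pow_succ, smul_smul]

theorem sliceMat_pairMatP_comulRed_etaP : sliceMat Q (pairMatP Q) (comulRed Q (etaP Q))
    = !![Q.q⁻¹ • etaP Q, (Complex.I * Q.qh) • 1; 0, Q.q • etaP Q] := by
  rw [comulRed_etaP, map_add, sliceMat_tmul, sliceMat_tmul, pairMatP_etaP, pairMatP_del]
  ext i j; fin_cases i <;> fin_cases j <;> simp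

theorem sliceMat_pairMatP_comulRed_etaM : sliceMat Q (pairMatP Q) (comulRed Q (etaM Q))
    = !![Q.q • etaM Q, 0; 0, Q.q⁻¹ • etaM Q] := by
  rw [comulRed_etaM, map_add, sliceMat_tmul, sliceMat_tmul, pairMatP_etaM, pairMatP_delInv]
  ext i j; fin_cases i <;> fin_cases j <;> simp

theorem sliceMat_pairMatM_comulRed_etaP : sliceMat Q (pairMatM Q) (comulRed Q (etaP Q))
    = !![Q.q⁻¹ • etaP Q, 0; 0, Q.q • etaP Q] := by
  rw [comulRed_etaP, map_add, sliceMat_tmul, sliceMat_tmul, pairMatM_etaP, pairMatM_del]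
  ext i j; fin_cases i <;> fin_cases j <;> simp

theorem sliceMat_pairMatM_comulRed_etaM : sliceMat Q (pairMatM Q) (comulRed Q (etaM Q))
    = !![Q.q • etaM Q, (Complex.I * Q.qh⁻¹) • 1; 0, Q.q⁻¹ • etaM Q] := by
  rw [comulRed_etaM, map_add, sliceMat_tmul, sliceMat_tmul, pairMatM_etaM, pairMatM_delInv]
  ext i j; fin_cases i <;> fin_cases j <;> simp

theorem sliceMat_pairMatP_comulRed (k n : ℕ) :
    sliceMat Q (pairMatP Q) (comulRed Q (etaP Q ^ k * etaM Q ^ n))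
      = !![Q.q⁻¹ ^ k • etaP Q ^ k, (Complex.I * Q.qh * Q.qNum k) • etaP Q ^ (k - 1);
          0, Q.q ^ k • etaP Q ^ k]
        * !![Q.q ^ n • etaM Q ^ n, 0; 0, Q.q⁻¹ ^ n • etaM Q ^ n] := by
  rw [map_mul, map_mul, map_pow, map_pow, map_pow, map_pow, sliceMat_pairMatP_comulRed_etaP,
    sliceMat_pairMatP_comulRed_etaM]
  exact congrArg₂ _ (upper_pow _ _ _ _ _ Q.qNum_zero Q.qNum_succ k) (diag_smul_pow _ _ _ n)

theorem sliceMat_pairMatM_comulRed (k n : ℕ) :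
    sliceMat Q (pairMatM Q) (comulRed Q (etaP Q ^ k * etaM Q ^ n))
      = !![Q.q⁻¹ ^ k • etaP Q ^ k, 0; 0, Q.q ^ k • etaP Q ^ k]
        * !![Q.q ^ n • etaM Q ^ n, (Complex.I * Q.qh⁻¹ * Q.qNum n) • etaM Q ^ (n - 1);
          0, Q.q⁻¹ ^ n • etaM Q ^ n] := by
  rw [map_mul, map_mul, map_pow, map_pow, map_pow, map_pow, sliceMat_pairMatM_comulRed_etaP,
    sliceMat_pairMatM_comulRed_etaM]
  exact congrArg₂ _ (diag_smul_pow _ _ _ k) (upper_pow _ _ _ _ _ Q.qNum_zero Q.qNum_succ_inv n)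

theorem sliceMat_pairMatP_BM : sliceMat Q (pairMatP Q) (BM Q) = 0 := by
  rw [BM, map_smul, map_sum, Finset.sum_eq_zero, smul_zero]
  intro n hn
  rw [Finset.mem_Ico] at hn
  rw [map_smul, sliceMat_tmul, map_mul, map_pow, pairMatP_etaM, zero_pow (by omega), zero_mul]
  ext i j; simp

theorem sliceMat_pairMatM_BP : sliceMat Q (pairMatM Q) (BP Q) = 0 := by
  rw [BP, map_smul, map_sum, Finset.sum_eq_zero, smul_zero]
  intro n hn
  rw [Finset.mem_Ico] at hn
  rw [map_smul, sliceMat_tmul, map_mul, map_pow, pairMatM_etaP, zero_pow (by omega), zero_mul]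
  ext i j; simp

theorem corner_pow_eq_zero (c : ℂ) {n : ℕ} (hn : 2 ≤ n) :
    (!![0, c; 0, 0] : Matrix (Fin 2) (Fin 2) ℂ) ^ n = 0 := by
  refine pow_eq_zero_of_le hn ?_
  simp only [pow_two, Matrix.mul_fin_two]
  ext i j; fin_cases i <;> fin_cases j <;> simp

theorem q_pow_pred_sq : Q.q ^ ((Q.p - 1) ^ 2) = Q.q := by
  rw [pow_two, pow_mul, Q.q_pow_pred, inv_pow, Q.q_pow_pred, inv_inv]

/-- Only the summand `n = p - 1`, linear in `η₊` on the left, pairs with `p₊`. -/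
theorem sliceMat_pairMatP_BP : sliceMat Q (pairMatP Q) (BP Q)
    = !![0, ((-1) ^ ((Q.p + 1) / 2) * (Complex.I * Q.qh) / Q.qFact (Q.p - 1)) •
        etaP Q ^ (Q.p - 1); 0, 0] := by
  have hp := Q.one_lt_p
  rw [BP, map_smul, map_sum, Finset.sum_eq_single_of_mem (Q.p - 1) (Finset.mem_Ico.2 (by omega))]
  · have h1 : Q.p - (Q.p - 1) = 1 := by omega
    have hq := Q.q_ne_zero
    rw [map_smul, sliceMat_tmul, h1, pow_one, map_mul, map_pow, pairMatP_etaP, pairMatP_del,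
      delInv_diag, Matrix.mul_fin_two, q_pow_pred_sq, Q.qFact_succ 0, Q.qFact_zero, Q.qNum_one]
    ext i j; fin_cases i <;> fin_cases j <;> simp [smul_smul]
    congr 1
    field_simp
  · intro n hn hne
    rw [Finset.mem_Ico] at hn
    rw [map_smul, sliceMat_tmul, map_mul, map_pow, pairMatP_etaP,
      corner_pow_eq_zero _ (by omega), zero_mul]
    ext i j; simp

/-- Only the summand `n = p - 1`, linear in `η₋` on the left, pairs with `p₋`. -/
theorem sliceMat_pairMatM_BM : sliceMat Q (pairMatM Q) (BM Q)
    = !![0, ((-1) ^ ((Q.p + 1) / 2) * (Complex.I * Q.qh⁻¹) / Q.qFact (Q.p - 1)) •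
        etaM Q ^ (Q.p - 1); 0, 0] := by
  have hp := Q.one_lt_p
  rw [BM, map_smul, map_sum, Finset.sum_eq_single_of_mem (Q.p - 1) (Finset.mem_Ico.2 (by omega))]
  · have h1 : Q.p - (Q.p - 1) = 1 := by omega
    have hq := Q.q_ne_zero
    rw [map_smul, sliceMat_tmul, h1, pow_one, map_mul, map_pow, pairMatM_etaM, pairMatM_delInv,
      diag_two_pow, inv_pow Q.q (Q.p - 1), Q.q_pow_pred, inv_inv, Matrix.mul_fin_two, inv_pow,
      q_pow_pred_sq, Q.qFact_succ 0, Q.qFact_zero, Q.qNum_one]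
    ext i j; fin_cases i <;> fin_cases j <;> simp [smul_smul]
    congr 1
    field_simp
  · intro n hn hne
    rw [Finset.mem_Ico] at hn
    rw [map_smul, sliceMat_tmul, map_mul, map_pow, pairMatM_etaM,
      corner_pow_eq_zero _ (by omega), zero_mul]
    ext i j; simp

/-! ### The right regular representation on monomials -/

theorem etaM_pow_mul_etaP_pow (n k : ℕ) :
    etaM Q ^ n * etaP Q ^ k = (Q.q ^ 2) ^ (n * k) • (etaP Q ^ k * etaM Q ^ n) := by
  have h1 : ∀ k, etaM Q * etaP Q ^ k = (Q.q ^ 2) ^ k • (etaP Q ^ k * etaM Q) := by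
    intro k
    induction k with
    | zero => simp
    | succ k ih =>
      rw [pow_succ, ← mul_assoc, ih, smul_mul_assoc, mul_assoc, etaM_mul_etaP, mul_smul_comm,
        smul_smul, mul_assoc, pow_succ (Q.q ^ 2)]
  induction n with
  | zero => simp
  | succ n ih =>
    rw [pow_succ, mul_assoc, h1, mul_smul_comm, ← mul_assoc, ih, smul_mul_assoc, smul_smul,
      mul_assoc, ← pow_add, add_mul, one_mul, add_comm k]

section
variable {E : Smooth R2} {cP cM : ℂ} (hP : dP E = cP • E) (hM : dM E = cM • E)
  (hE : evalFst (pullAdd E) = E)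
include hP hM hE

theorem RP_tmul (k n : ℕ) :
    RP Q ((etaP Q ^ k * etaM Q ^ n) ⊗ₜ[ℂ] E)
      = ((Q.q⁻¹ ^ n * (Complex.I * Q.qh * Q.qNum k)) • (etaP Q ^ (k - 1) * etaM Q ^ n)
        + (Q.q⁻¹ ^ k * Q.q ^ n * (cP * ((-1) ^ ((Q.p + 1) / 2) * (Complex.I * Q.qh)
            / Q.qFact (Q.p - 1)))) • (etaP Q ^ k * etaM Q ^ n * etaP Q ^ (Q.p - 1))) ⊗ₜ[ℂ] E := by
  rw [RP, LinearMap.comp_apply, pairP, slice_comul_tmul _ _ hP hM hE, sliceMat_pairMatP_BM,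
    sliceMat_pairMatP_BP, sliceMat_pairMatP_comulRed, Matrix.one_fin_two]
  congr 1
  simp [Matrix.mul_apply, Fin.sum_univ_two, smul_smul]
  rw [add_comm]
  congr 2 <;> ring

theorem RM_tmul (k n : ℕ) :
    RM Q ((etaP Q ^ k * etaM Q ^ n) ⊗ₜ[ℂ] E)
      = ((Q.q⁻¹ ^ k * (Complex.I * Q.qh⁻¹ * Q.qNum n)) • (etaP Q ^ k * etaM Q ^ (n - 1))
        + (Q.q⁻¹ ^ k * Q.q ^ n * (cM * ((-1) ^ ((Q.p + 1) / 2) * (Complex.I * Q.qh⁻¹)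
            / Q.qFact (Q.p - 1)))) • (etaP Q ^ k * etaM Q ^ n * etaM Q ^ (Q.p - 1))) ⊗ₜ[ℂ] E := by
  rw [RM, LinearMap.comp_apply, pairM, slice_comul_tmul _ _ hP hM hE, sliceMat_pairMatM_BM,
    sliceMat_pairMatM_BP, sliceMat_pairMatM_comulRed, Matrix.one_fin_two]
  congr 1
  simp [Matrix.mul_apply, Fin.sum_univ_two, smul_smul]
  rw [add_comm]
  congr 2
  ring

/-- For positive exponents of `η₊` the contribution of `B₊` contains `η₊^p` and vanishes. -/
theorem RP_tmul_succ {k : ℕ} (n : ℕ) :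
    RP Q ((etaP Q ^ (k + 1) * etaM Q ^ n) ⊗ₜ[ℂ] E)
      = (Q.q⁻¹ ^ n * (Complex.I * Q.qh * Q.qNum (k + 1))) •
        ((etaP Q ^ k * etaM Q ^ n) ⊗ₜ[ℂ] E) := by
  have hp := Q.one_lt_p
  rw [RP_tmul hP hM hE, mul_assoc (etaP Q ^ _), etaM_pow_mul_etaP_pow, mul_smul_comm,
    ← mul_assoc (etaP Q ^ _), ← pow_add, show k + 1 + (Q.p - 1) = Q.p + k by omega, pow_add _ Q.p,
    etaP_pow]
  simp [TensorProduct.smul_tmul']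

/-- The monomial without `η₊` is sent to the top power `η₊^{p-1}` by the term `∂₊f(Z) B₊` alone. -/
theorem RP_tmul_zero (n : ℕ) :
    RP Q ((etaP Q ^ 0 * etaM Q ^ n) ⊗ₜ[ℂ] E)
      = (Q.q⁻¹ ^ n * (cP * ((-1) ^ ((Q.p + 1) / 2) * (Complex.I * Q.qh) / Q.qFact (Q.p - 1)))) •
        ((etaP Q ^ (Q.p - 1) * etaM Q ^ n) ⊗ₜ[ℂ] E) := by
  have hq := Q.q_ne_zero
  have h : Q.q ^ n * (Q.q ^ 2) ^ (n * (Q.p - 1)) = Q.q⁻¹ ^ n := by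
    rw [mul_comm n, pow_mul, ← pow_mul Q.q, mul_comm 2, pow_mul Q.q, Q.q_pow_pred, ← mul_pow]
    congr 1; field_simp
  rw [RP_tmul hP hM hE, mul_assoc (etaP Q ^ _), etaM_pow_mul_etaP_pow, Q.qNum_zero, mul_zero,
    mul_zero, zero_smul, zero_add, pow_zero, one_mul, pow_zero, one_mul, smul_smul,
    TensorProduct.smul_tmul']
  congr 2
  linear_combination (cP * ((-1) ^ ((Q.p + 1) / 2) * (Complex.I * Q.qh) / Q.qFact (Q.p - 1))) * h

/-- For positive exponents of `η₋` the contribution of `B₋` contains `η₋^p` and vanishes. -/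
theorem RM_tmul_succ (k : ℕ) {n : ℕ} :
    RM Q ((etaP Q ^ k * etaM Q ^ (n + 1)) ⊗ₜ[ℂ] E)
      = (Q.q⁻¹ ^ k * (Complex.I * Q.qh⁻¹ * Q.qNum (n + 1))) •
        ((etaP Q ^ k * etaM Q ^ n) ⊗ₜ[ℂ] E) := by
  have hp := Q.one_lt_p
  rw [RM_tmul hP hM hE, mul_assoc (etaP Q ^ _), ← pow_add,
    show n + 1 + (Q.p - 1) = Q.p + n by omega, pow_add _ Q.p, etaM_pow]
  simp [TensorProduct.smul_tmul']

/-- The monomial without `η₋` is sent to the top power `η₋^{p-1}` by the term `∂₋f(Z) B₋` alone. -/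
theorem RM_tmul_zero (k : ℕ) :
    RM Q ((etaP Q ^ k * etaM Q ^ 0) ⊗ₜ[ℂ] E)
      = (Q.q⁻¹ ^ k * (cM * ((-1) ^ ((Q.p + 1) / 2) * (Complex.I * Q.qh⁻¹) / Q.qFact (Q.p - 1)))) •
        ((etaP Q ^ k * etaM Q ^ (Q.p - 1)) ⊗ₜ[ℂ] E) := by
  rw [RM_tmul hP hM hE, Q.qNum_zero, mul_zero, mul_zero, zero_smul, zero_add, pow_zero, pow_zero,
    mul_one, mul_one, TensorProduct.smul_tmul']

end

/-! ### The cyclic representation on basis vectors -/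

theorem tens_mul (M N : Module.End ℂ (ASO Q)) (F G : AE Q) :
    tens Q M F * tens Q N G = tens Q (M * N) (F * G) := by
  rw [tens, tens, tens, ← TensorProduct.map_mul, LinearMap.mulLeft_mul]
  rfl

theorem tens_one : tens Q 1 1 = 1 := by
  rw [tens, LinearMap.mulLeft_one]
  exact TensorProduct.map_id

theorem tens_pow (M : Module.End ℂ (ASO Q)) (F : AE Q) (n : ℕ) :
    tens Q M F ^ n = tens Q (M ^ n) (F ^ n) := by
  induction n with
  | zero => simp [tens_one]
  | succ n ih => rw [pow_succ, ih, tens_mul, ← pow_succ, ← pow_succ]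

theorem tens_tmul (M : Module.End ℂ (ASO Q)) (F G : AE Q) (a : ASO Q) :
    tens Q M F (a ⊗ₜ[ℂ] G) = M a ⊗ₜ[ℂ] (F * G) := by
  simp [tens]

theorem LP_basis (l : ℂ) (m : ZMod Q.p) : LP Q l (basisSO Q m) = l • basisSO Q (m + 1) := by
  simp [LP]

theorem LM_basis (l : ℂ) (m : ZMod Q.p) : LM Q l (basisSO Q m) = l • basisSO Q (m - 1) := by
  simp [LM]

theorem LK_basis (m : ZMod Q.p) : LK Q (basisSO Q m) = Q.q ^ m.val • basisSO Q m := by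
  simp [LK]

theorem LK_pow_basis (m : ZMod Q.p) (n : ℕ) :
    (LK Q ^ n) (basisSO Q m) = (Q.q ^ m.val) ^ n • basisSO Q m := by
  induction n with
  | zero => simp
  | succ n ih => rw [pow_succ, Module.End.mul_apply, LK_basis, map_smul, ih, smul_smul, pow_succ,
      mul_comm]

theorem LP_pow_p (l : ℂ) : LP Q l ^ Q.p = l ^ Q.p • 1 := by
  have h : ∀ (n : ℕ) (m : ZMod Q.p), (LP Q l ^ n) (basisSO Q m) = l ^ n • basisSO Q (m + n) := by
    intro n
    induction n with
    | zero => simp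
    | succ n ih =>
      intro m
      rw [pow_succ, Module.End.mul_apply, LP_basis, map_smul, ih, smul_smul, pow_succ, mul_comm]
      push_cast
      rw [add_assoc, add_comm 1]
  refine (basisSO Q).ext fun m => ?_
  rw [h]; simp

theorem LM_pow_p (l : ℂ) : LM Q l ^ Q.p = l ^ Q.p • 1 := by
  have h : ∀ (n : ℕ) (m : ZMod Q.p), (LM Q l ^ n) (basisSO Q m) = l ^ n • basisSO Q (m - n) := by
    intro n
    induction n with
    | zero => simp
    | succ n ih =>
      intro m
      rw [pow_succ, Module.End.mul_apply, LM_basis, map_smul, ih, smul_smul, pow_succ, mul_comm]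
      push_cast
      rw [sub_sub, add_comm 1]
  refine (basisSO Q).ext fun m => ?_
  rw [h]; simp

/-- The action of `κ⁻¹` on `δ^m`, for an integer representative of `m`. -/
theorem LK_inv_basis (m : ℤ) :
    (LK Q ^ (Q.p - 1)) (basisSO Q (m : ZMod Q.p)) = Q.q ^ (-m) • basisSO Q (m : ZMod Q.p) := by
  have h : Q.q ^ (m : ZMod Q.p).val = Q.q ^ m := by
    have h1 : ((m : ZMod Q.p).val : ℤ) = m % Q.p := ZMod.val_intCast m
    rw [← zpow_natCast, h1]
    conv_rhs => rw [← Int.emod_add_mul_ediv m Q.p]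
    rw [zpow_add₀ Q.q_ne_zero, zpow_mul, zpow_natCast, Q.prim.pow_eq_one, one_zpow, mul_one]
  rw [LK_pow_basis, ← pow_mul, mul_comm, pow_mul, Q.q_pow_pred, inv_pow, h, zpow_neg]

theorem LepsP_basis (l : ℂ) (m : ℤ) : LepsP Q l (basisSO Q (m : ZMod Q.p))
    = (-(Q.qh⁻¹ * l * Q.q ^ (-m))) • basisSO Q ((m + 1 : ℤ) : ZMod Q.p) := by
  rw [LepsP, LinearMap.neg_apply, LinearMap.smul_apply, Module.End.mul_apply, LK_inv_basis,
    map_smul, LP_basis, smul_smul, smul_smul, neg_smul]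
  push_cast
  congr 2; ring

theorem LepsM_basis (l : ℂ) (m : ℤ) : LepsM Q l (basisSO Q (m : ZMod Q.p))
    = (-(Q.qh * l * Q.q ^ (-m))) • basisSO Q ((m - 1 : ℤ) : ZMod Q.p) := by
  rw [LepsM, LinearMap.neg_apply, LinearMap.smul_apply, Module.End.mul_apply, LK_inv_basis,
    map_smul, LM_basis, smul_smul, smul_smul, neg_smul]
  push_cast
  congr 2; ring

theorem LepsM_pow_basis (l : ℂ) (n : ℕ) : (LepsM Q l ^ n) (basisSO Q 0)
    = ((-(Q.qh * l)) ^ n * Q.q ^ (n * (n - 1) / 2)) • basisSO Q ((-n : ℤ) : ZMod Q.p) := by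
  induction n with
  | zero => simp
  | succ n ih =>
    rw [pow_succ', Module.End.mul_apply, ih, map_smul, LepsM_basis, smul_smul, neg_neg,
      zpow_natCast, ← Finset.sum_range_id, ← Finset.sum_range_id,
      Finset.sum_range_succ, pow_add, show (-(n : ℤ) - 1) = -((n + 1 : ℕ) : ℤ) by push_cast; ring,
      pow_succ (-(Q.qh * l))]
    congr 1; ring

theorem LepsP_pow_basis (l : ℂ) (k : ℕ) (m : ℤ) :
    (LepsP Q l ^ k) (basisSO Q (m : ZMod Q.p)) = ((-(Q.qh⁻¹ * l)) ^ k * (Q.q ^ (-m)) ^ k *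
      Q.q⁻¹ ^ (k * (k - 1) / 2)) • basisSO Q ((m + k : ℤ) : ZMod Q.p) := by
  induction k with
  | zero => simp
  | succ k ih =>
    rw [pow_succ', Module.End.mul_apply, ih, map_smul, LepsP_basis, smul_smul,
      ← Finset.sum_range_id, ← Finset.sum_range_id,
      Finset.sum_range_succ, show (m + k + 1 : ℤ) = m + ((k + 1 : ℕ) : ℤ) by push_cast; ring,
      pow_succ (-(Q.qh⁻¹ * l)) k, pow_succ (Q.q ^ (-m)) k, neg_add, zpow_add₀ Q.q_ne_zero,
      zpow_neg Q.q k, zpow_natCast, pow_add Q.q⁻¹, inv_pow Q.q k]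
    congr 1; ring

/-- `D(L(κ), δ)` fixes `δ⁰ ⊗ 1`, since `∑ₘ q^{-mk}` vanishes unless `k = 0`. -/
theorem Dop_one : Dop Q (basisSO Q 0 ⊗ₜ[ℂ] 1) = basisSO Q 0 ⊗ₜ[ℂ] 1 := by
  have hp := Q.one_lt_p
  have hp0 : (Q.p : ℂ) ≠ 0 := Nat.cast_ne_zero.2 (by omega)
  simp only [Dop, LinearMap.smul_apply, LinearMap.sum_apply, tens_tmul, LK_pow_basis]
  rw [Finset.sum_comm, Finset.sum_eq_single_of_mem 0 (Finset.mem_range.2 (by omega))]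
  · simp [hp0, ← Algebra.TensorProduct.one_def, ← Nat.cast_smul_eq_nsmul ℂ, smul_smul]
  · intro k hk hk0
    rw [Finset.mem_range] at hk
    simp only [ZMod.val_zero, pow_zero, one_pow, one_smul]
    rw [← Finset.sum_smul]
    have h : ∑ m ∈ Finset.range Q.p, Q.q⁻¹ ^ (m * k) = 0 := by
      have h1 : Q.q⁻¹ ^ k ≠ 1 := Q.prim.inv.pow_ne_one_of_pos_of_lt hk0 hk
      have h2 := mul_neg_geom_sum (Q.q⁻¹ ^ k) Q.p
      rw [← pow_mul, mul_comm k, pow_mul, Q.prim.inv.pow_eq_one, one_pow, sub_self] at h2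
      simpa only [mul_comm _ k, pow_mul] using
        (mul_eq_zero.1 h2).resolve_left (sub_ne_zero.2 h1.symm)
    rw [h, zero_smul]

/-! ### The plane wave factor -/

variable (Q)

/-- The plane wave `z ↦ exp(a z₊ + b z₋)`. -/
def planeWave (a b : ℂ) : Smooth R2 :=
  ⟨fun z => Complex.exp (a * (z.1 : ℂ) + b * (z.2 : ℂ)),
    show ContDiff ℝ ∞ fun z : R2 => Complex.exp (a * (z.1 : ℂ) + b * (z.2 : ℂ)) from
    Complex.contDiff_exp.comp
      ((contDiff_const.mul (Complex.ofRealCLM.contDiff.comp contDiff_fst)).add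
        (contDiff_const.mul (Complex.ofRealCLM.contDiff.comp contDiff_snd)))⟩

theorem dir_planeWave (a b : ℂ) (v : R2) :
    dir v (planeWave a b) = (a * (v.1 : ℂ) + b * (v.2 : ℂ)) • planeWave a b := by
  ext z
  have h1 : HasFDerivAt (fun z : R2 => a * (z.1 : ℂ) + b * (z.2 : ℂ))
      (a • (Complex.ofRealCLM.comp (ContinuousLinearMap.fst ℝ ℝ ℝ))
        + b • (Complex.ofRealCLM.comp (ContinuousLinearMap.snd ℝ ℝ ℝ))) z :=
    ((Complex.ofRealCLM.comp (ContinuousLinearMap.fst ℝ ℝ ℝ)).hasFDerivAt.const_mul a).add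
      ((Complex.ofRealCLM.comp (ContinuousLinearMap.snd ℝ ℝ ℝ)).hasFDerivAt.const_mul b)
  have h2 := h1.cexp.fderiv
  change fderiv ℝ (fun z : R2 => Complex.exp (a * (z.1 : ℂ) + b * (z.2 : ℂ))) z v
    = (a * (v.1 : ℂ) + b * (v.2 : ℂ)) * Complex.exp (a * (z.1 : ℂ) + b * (z.2 : ℂ))
  rw [h2]
  simp only [smul_apply, add_apply, smul_eq_mul,
    ContinuousLinearMap.comp_apply, ContinuousLinearMap.coe_fst', ContinuousLinearMap.coe_snd',
    Complex.ofRealCLM_apply]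
  ring

theorem dP_planeWave (a b : ℂ) : dP (planeWave a b) = a • planeWave a b := by
  simpa [dP] using dir_planeWave a b (1, 0)

theorem dM_planeWave (a b : ℂ) : dM (planeWave a b) = b • planeWave a b := by
  simpa [dM] using dir_planeWave a b (0, 1)

theorem evalFst_pullAdd (f : Smooth R2) : evalFst (pullAdd f) = f := by
  ext w
  change (f : R2 → ℂ) (0 + w) = (f : R2 → ℂ) w
  rw [zero_add]

/-- `L(P₊)` and `L(P₋)` are scalars, so the matrix exponential is a scalar matrix. -/
theorem expEntry_smul_one (a b : ℂ) (i j : ZMod Q.p) :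
    expEntry Q (mat Q (a • 1)) (mat Q (b • 1)) i j
      = if i = j then planeWave (-(Complex.I * a)) (-(Complex.I * b)) else 0 := by
  have hm : ∀ c : ℂ, mat Q (c • 1) = Matrix.diagonal fun _ => c := by
    intro c
    rw [mat, map_smul, LinearMap.toMatrix_one, Matrix.smul_one_eq_diagonal]
  ext z
  change (NormedSpace.exp (-((Complex.I * (z.1 : ℂ)) • mat Q (a • 1))
    - (Complex.I * (z.2 : ℂ)) • mat Q (b • 1))) i j = _
  have h : -((Complex.I * (z.1 : ℂ)) • mat Q (a • 1)) - (Complex.I * (z.2 : ℂ)) • mat Q (b • 1)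
      = Matrix.diagonal fun _ => -(Complex.I * a) * (z.1 : ℂ) + -(Complex.I * b) * (z.2 : ℂ) := by
    rw [hm, hm]
    ext k l
    by_cases hkl : k = l
    · subst hkl
      simp only [Matrix.sub_apply, Matrix.neg_apply, Matrix.smul_apply, Matrix.diagonal_apply_eq,
        smul_eq_mul]
      ring
    · simp [Matrix.diagonal_apply_ne _ hkl]
  rw [h, Matrix.exp_diagonal]
  by_cases hij : i = j
  · subst hij
    rw [Matrix.diagonal_apply_eq, if_pos rfl, Pi.coe_exp]
    exact (congrFun Complex.exp_eq_exp_ℂ _).symm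
  · rw [Matrix.diagonal_apply_ne _ hij, if_neg hij]
    rfl

theorem expOp_smul_one (a b : ℂ) : expOp Q (a • 1) (b • 1)
    = tens Q 1 (1 ⊗ₜ[ℂ] planeWave (-(Complex.I * a)) (-(Complex.I * b))) := by
  have h : ∀ i : ZMod Q.p, ∑ j, tens Q
      ((LinearMap.toMatrix (basisSO Q) (basisSO Q)).symm (Matrix.single i j 1))
        (1 ⊗ₜ[ℂ] expEntry Q (mat Q (a • 1)) (mat Q (b • 1)) i j)
      = tens Q ((LinearMap.toMatrix (basisSO Q) (basisSO Q)).symm (Matrix.single i i 1))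
        (1 ⊗ₜ[ℂ] planeWave (-(Complex.I * a)) (-(Complex.I * b))) := by
    intro i
    rw [Finset.sum_eq_single_of_mem i (Finset.mem_univ i), expEntry_smul_one, if_pos rfl]
    intro j _ hj
    rw [expEntry_smul_one, if_neg hj.symm]
    simp [tens]
  rw [expOp, Finset.sum_congr rfl fun i _ => h i]
  have h1 : (1 : Module.End ℂ (ASO Q)) = ∑ i : ZMod Q.p,
      (LinearMap.toMatrix (basisSO Q) (basisSO Q)).symm (Matrix.single i i 1) := by
    rw [← map_sum, LinearEquiv.eq_symm_apply, LinearMap.toMatrix_one]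
    ext k l
    rw [Matrix.sum_apply, Finset.sum_eq_single_of_mem k (Finset.mem_univ k)]
    · simp [Matrix.single_apply, Matrix.one_apply]
    · intro i _ hi
      simp [hi]
  rw [h1]
  refine TensorProduct.ext' fun a G => ?_
  simp only [LinearMap.sum_apply, tens_tmul, TensorProduct.sum_tmul]

/-! ### The matrix elements `D^λ_{m0}` as sums of monomials -/

/-- The coefficient of `η₊^k η₋^n` in `D^λ_{m0}`, where `m ≡ k - n`. -/
def coef (lP lM : ℂ) (k n : ℕ) : ℂ :=
  (-(Complex.I * Q.qh⁻¹ * lP)) ^ k * (-(Complex.I * Q.qh * lM)) ^ n * Q.q ^ (n * k)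
    / (Q.qFact k * Q.qFact n)

/-- The common smooth factor `exp(-i λ₊^p z₊ - i λ₋^p z₋)` of the matrix elements. -/
def wave (lP lM : ℂ) : Smooth R2 :=
  planeWave (-(Complex.I * lP ^ Q.p)) (-(Complex.I * lM ^ Q.p))

variable {Q}

/-- The power of `q` in the cut off exponential cancels the one from `LepsM_pow_basis`. -/
theorem cutExpM_basis (lM : ℂ) :
    cutExpM Q (Complex.I • tens Q (LepsM Q lM) (etaM Q ⊗ₜ[ℂ] 1)) (basisSO Q 0 ⊗ₜ[ℂ] 1)
      = ∑ n ∈ Finset.range Q.p, ((-(Complex.I * Q.qh * lM)) ^ n / Q.qFact n) •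
        (basisSO Q ((-n : ℤ) : ZMod Q.p) ⊗ₜ[ℂ] ((etaM Q ^ n) ⊗ₜ[ℂ] (1 : Smooth R2))) := by
  rw [cutExpM, LinearMap.sum_apply]
  refine Finset.sum_congr rfl fun n _ => ?_
  rw [smul_pow, tens_pow, LinearMap.smul_apply, LinearMap.smul_apply, tens_tmul, mul_one,
    LepsM_pow_basis, Algebra.TensorProduct.tmul_pow, one_pow, ← TensorProduct.smul_tmul',
    smul_smul, smul_smul]
  congr 1
  have hq := pow_ne_zero (n * (n - 1) / 2) Q.q_ne_zero
  rw [show -(Complex.I * Q.qh * lM) = Complex.I * -(Q.qh * lM) by ring, mul_pow, inv_pow]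
  field_simp

theorem cutExpP_basis (lP : ℂ) (n : ℕ) :
    cutExpP Q (Complex.I • tens Q (LepsP Q lP) (etaP Q ⊗ₜ[ℂ] 1))
        (basisSO Q ((-n : ℤ) : ZMod Q.p) ⊗ₜ[ℂ] ((etaM Q ^ n) ⊗ₜ[ℂ] (1 : Smooth R2)))
      = ∑ k ∈ Finset.range Q.p,
        ((-(Complex.I * Q.qh⁻¹ * lP)) ^ k * Q.q ^ (n * k) / Q.qFact k) •
          (basisSO Q ((-n + k : ℤ) : ZMod Q.p) ⊗ₜ[ℂ]
            ((etaP Q ^ k * etaM Q ^ n) ⊗ₜ[ℂ] (1 : Smooth R2))) := by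
  rw [cutExpP, LinearMap.sum_apply]
  refine Finset.sum_congr rfl fun k _ => ?_
  rw [smul_pow, tens_pow, LinearMap.smul_apply, LinearMap.smul_apply, tens_tmul,
    LepsP_pow_basis, Algebra.TensorProduct.tmul_pow, one_pow,
    Algebra.TensorProduct.tmul_mul_tmul, one_mul, ← TensorProduct.smul_tmul',
    smul_smul, smul_smul]
  congr 1
  have hq := pow_ne_zero (k * (k - 1) / 2) Q.q_ne_zero
  rw [show -(Complex.I * Q.qh⁻¹ * lP) = Complex.I * -(Q.qh⁻¹ * lP) by ring, mul_pow, inv_pow,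
    neg_neg, zpow_natCast, ← pow_mul]
  field_simp

theorem T_one (lP lM : ℂ) : T Q lP lM (basisSO Q 0)
    = ∑ n ∈ Finset.range Q.p, ∑ k ∈ Finset.range Q.p, coef Q lP lM k n •
      (basisSO Q ((-n + k : ℤ) : ZMod Q.p) ⊗ₜ[ℂ]
        ((etaP Q ^ k * etaM Q ^ n) ⊗ₜ[ℂ] wave Q lP lM)) := by
  rw [T, LinearMap.comp_apply, LinearMap.flip_apply, TensorProduct.mk_apply,
    Module.End.mul_apply, Module.End.mul_apply, Module.End.mul_apply, Dop_one, cutExpM_basis,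
    LP_pow_p, LM_pow_p, expOp_smul_one, map_sum, map_sum]
  refine Finset.sum_congr rfl fun n _ => ?_
  rw [map_smul, cutExpP_basis, map_smul, map_sum, Finset.smul_sum]
  refine Finset.sum_congr rfl fun k _ => ?_
  rw [map_smul, tens_tmul, Algebra.TensorProduct.tmul_mul_tmul, one_mul, mul_one,
    Module.End.one_apply, smul_smul, wave]
  congr 1
  rw [coef, div_mul_div_comm]
  congr 1 <;> ring

theorem delta_pow (n : ℕ) : delta Q ^ n = basisSO Q (n : ZMod Q.p) := by
  simp [delta, basisSO, AddMonoidAlgebra.single_pow]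

theorem formSO_basis (i j : ZMod Q.p) :
    formSO Q (basisSO Q i) (basisSO Q j) = if i + j = 0 then 1 else 0 := by
  have h : starSO Q (basisSO Q i) = basisSO Q i := by
    rw [starSO, Finset.sum_eq_single_of_mem i (Finset.mem_univ i)]
    · simp [basisSO]
    · intro m _ hm
      simp [basisSO, hm.symm]
  have h2 : basisSO Q i * basisSO Q j = basisSO Q (i + j) := by
    simp [basisSO, AddMonoidAlgebra.single_mul_single]
  rw [formSO, LinearMap.comp_apply, LinearMap.mulLeft_apply, h, h2, intSO, Module.Basis.coord_apply,
    Module.Basis.repr_self, Finsupp.single_apply]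

/-- The expansion of `D^λ_{m0}`. Bounding `m` by `p` keeps the exponent `p - m` free of truncation. -/
theorem D_zero (lP lM : ℂ) {m : ℕ} (hm : m ≤ Q.p) : D Q lP lM m 0
    = ∑ n ∈ Finset.range Q.p, ∑ k ∈ Finset.range Q.p,
      if (k : ZMod Q.p) = m + n then
        coef Q lP lM k n • ((etaP Q ^ k * etaM Q ^ n) ⊗ₜ[ℂ] wave Q lP lM) else 0 := by
  rw [D, delta_pow, delta_pow, Nat.cast_zero, T_one, map_sum]
  refine Finset.sum_congr rfl fun n _ => ?_
  rw [map_sum]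
  refine Finset.sum_congr rfl fun k _ => ?_
  rw [map_smul, formExt, LinearMap.comp_apply, LinearMap.rTensor_tmul, formSO_basis]
  have h : (((Q.p - m : ℕ) : ZMod Q.p) + ((-n + k : ℤ) : ZMod Q.p) = 0)
      ↔ (k : ZMod Q.p) = m + n := by
    rw [Nat.cast_sub hm, ZMod.natCast_self, ← sub_eq_zero (a := (k : ZMod Q.p))]
    push_cast
    rw [iff_iff_eq]
    congr 1
    ring
  by_cases hk : (k : ZMod Q.p) = m + n
  · rw [if_pos (h.2 hk), if_pos hk]; simp
  · rw [if_neg (mt h.1 hk), if_neg hk]; simp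

/-! ### The action on matrix elements -/

/-- The sign of `B±` in terms of the power of `-i` that occurs in the top coefficients. -/
theorem sign_pred : ((-1 : ℂ)) ^ ((Q.p + 1) / 2) = -(-Complex.I) ^ (Q.p - 1) := by
  obtain ⟨k, hk⟩ := Q.odd_p
  rw [hk, show (2 * k + 1 + 1) / 2 = k + 1 by omega, show 2 * k + 1 - 1 = 2 * k by omega, pow_mul,
    neg_sq, Complex.I_sq, pow_succ]
  ring

section
variable (lP lM : ℂ)

theorem RP_coef_succ (k n : ℕ) (hk : k + 1 < Q.p) :
    RP Q (coef Q lP lM (k + 1) n • ((etaP Q ^ (k + 1) * etaM Q ^ n) ⊗ₜ[ℂ] wave Q lP lM))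
      = lP • coef Q lP lM k n • ((etaP Q ^ k * etaM Q ^ n) ⊗ₜ[ℂ] wave Q lP lM) := by
  rw [map_smul, wave, RP_tmul_succ (dP_planeWave _ _) (dM_planeWave _ _) (evalFst_pullAdd _),
    smul_smul, smul_smul, coef, coef, Q.qFact_succ]
  congr 1
  have h1 := Q.qNum_ne_zero k.succ_pos hk
  have h2 := Q.qh_ne_zero
  have h3 := pow_ne_zero n Q.q_ne_zero
  rw [pow_succ, mul_add, mul_one, pow_add, inv_pow]
  field_simp
  rw [Complex.I_sq]
  ring

theorem RP_coef_zero (n : ℕ) :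
    RP Q (coef Q lP lM 0 n • ((etaP Q ^ 0 * etaM Q ^ n) ⊗ₜ[ℂ] wave Q lP lM))
      = lP • coef Q lP lM (Q.p - 1) n •
        ((etaP Q ^ (Q.p - 1) * etaM Q ^ n) ⊗ₜ[ℂ] wave Q lP lM) := by
  rw [map_smul, wave, RP_tmul_zero (dP_planeWave _ _) (dM_planeWave _ _) (evalFst_pullAdd _),
    smul_smul, smul_smul, coef, coef, sign_pred]
  congr 1
  have hl : lP ^ Q.p = lP ^ (Q.p - 1) * lP := by
    rw [← pow_succ, Nat.sub_add_cancel Q.one_lt_p.le]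
  have hc : (-(Complex.I * Q.qh⁻¹ * lP)) ^ (Q.p - 1)
      = -((-Complex.I) ^ (Q.p - 1) * Q.qh * lP ^ (Q.p - 1)) := by
    rw [show -(Complex.I * Q.qh⁻¹ * lP) = -Complex.I * Q.qh⁻¹ * lP by ring, mul_pow, mul_pow,
      inv_pow, Q.qh_pow_pred, inv_neg, inv_inv]
    ring
  rw [hc, mul_comm n (Q.p - 1), pow_mul Q.q (Q.p - 1), Q.q_pow_pred, hl, Q.qFact_zero, mul_zero,
    pow_zero, pow_zero]
  linear_combination ((-(Complex.I * Q.qh * lM)) ^ n * Q.q⁻¹ ^ n * lP ^ (Q.p - 1) * lP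
    * (-Complex.I) ^ (Q.p - 1) * Q.qh / (Q.qFact (Q.p - 1) * Q.qFact n)) * Complex.I_sq

theorem RM_coef_succ (k n : ℕ) (hn : n + 1 < Q.p) :
    RM Q (coef Q lP lM k (n + 1) • ((etaP Q ^ k * etaM Q ^ (n + 1)) ⊗ₜ[ℂ] wave Q lP lM))
      = lM • coef Q lP lM k n • ((etaP Q ^ k * etaM Q ^ n) ⊗ₜ[ℂ] wave Q lP lM) := by
  rw [map_smul, wave, RM_tmul_succ (dP_planeWave _ _) (dM_planeWave _ _) (evalFst_pullAdd _),
    smul_smul, smul_smul, coef, coef, Q.qFact_succ]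
  congr 1
  have h1 := Q.qNum_ne_zero n.succ_pos hn
  have h2 := Q.qh_ne_zero
  have h3 := pow_ne_zero k Q.q_ne_zero
  rw [pow_succ _ n, add_mul, one_mul, pow_add, inv_pow]
  field_simp
  rw [Complex.I_sq]
  ring

theorem RM_coef_zero (k : ℕ) :
    RM Q (coef Q lP lM k 0 • ((etaP Q ^ k * etaM Q ^ 0) ⊗ₜ[ℂ] wave Q lP lM))
      = lM • coef Q lP lM k (Q.p - 1) •
        ((etaP Q ^ k * etaM Q ^ (Q.p - 1)) ⊗ₜ[ℂ] wave Q lP lM) := by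
  rw [map_smul, wave, RM_tmul_zero (dP_planeWave _ _) (dM_planeWave _ _) (evalFst_pullAdd _),
    smul_smul, smul_smul, coef, coef, sign_pred]
  congr 1
  have hl : lM ^ Q.p = lM ^ (Q.p - 1) * lM := by
    rw [← pow_succ, Nat.sub_add_cancel Q.one_lt_p.le]
  have hc : (-(Complex.I * Q.qh * lM)) ^ (Q.p - 1)
      = -((-Complex.I) ^ (Q.p - 1) * Q.qh⁻¹ * lM ^ (Q.p - 1)) := by
    rw [show -(Complex.I * Q.qh * lM) = -Complex.I * Q.qh * lM by ring, mul_pow, mul_pow,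
      Q.qh_pow_pred]
    ring
  rw [hc, pow_mul Q.q (Q.p - 1), Q.q_pow_pred, hl, Q.qFact_zero, zero_mul, pow_zero, pow_zero]
  linear_combination ((-(Complex.I * Q.qh⁻¹ * lP)) ^ k * Q.q⁻¹ ^ k * lM ^ (Q.p - 1) * lM
    * (-Complex.I) ^ (Q.p - 1) * Q.qh⁻¹ / (Q.qFact (Q.p - 1) * Q.qFact k)) * Complex.I_sq

/-- A sum over a full period is unchanged by the cyclic shift `0 ↦ p - 1`, `k + 1 ↦ k`. -/
theorem sum_range_cyclic {A : Type*} [AddCommMonoid A] {p : ℕ} (hp : 0 < p) (f g : ℕ → A)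
    (h0 : f 0 = g (p - 1)) (hs : ∀ k, k + 1 < p → f (k + 1) = g k) :
    ∑ k ∈ Finset.range p, f k = ∑ k ∈ Finset.range p, g k := by
  obtain ⟨r, rfl⟩ : ∃ r, p = r + 1 := ⟨p - 1, by omega⟩
  rw [Finset.sum_range_succ', Finset.sum_range_succ, h0, Nat.add_sub_cancel]
  congr 1
  exact Finset.sum_congr rfl fun k hk => hs k (by have := Finset.mem_range.1 hk; omega)

theorem natCast_pred : ((Q.p - 1 : ℕ) : ZMod Q.p) = -1 := by
  rw [Nat.cast_sub Q.one_lt_p.le, ZMod.natCast_self, Nat.cast_one, zero_sub]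

/-- Both sides are compared for each fixed power of `η₋`: `R(p₊)` shifts the power of `η₊` cyclically
downwards, and the selection rule `k ≡ m + n` turns into `k ≡ m' + n`. -/
theorem RP_D {m m' : ℕ} (hm : m ≤ Q.p) (hm' : m' ≤ Q.p) (h : (m : ZMod Q.p) = m' + 1) :
    RP Q (D Q lP lM m 0) = lP • D Q lP lM m' 0 := by
  rw [D_zero _ _ hm, D_zero _ _ hm', map_sum, Finset.smul_sum]
  refine Finset.sum_congr rfl fun n _ => ?_
  rw [map_sum, Finset.smul_sum]
  refine sum_range_cyclic (by have := Q.one_lt_p; omega) _ _ ?_ fun k hk => ?_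
  · have e : ((0 : ℕ) : ZMod Q.p) = m + n ↔ ((Q.p - 1 : ℕ) : ZMod Q.p) = m' + n := by
      rw [natCast_pred, h, Nat.cast_zero]
      constructor <;> intro h'
      · linear_combination h'
      · linear_combination h'
    by_cases hk : ((0 : ℕ) : ZMod Q.p) = m + n
    · rw [if_pos hk, if_pos (e.1 hk), RP_coef_zero]
    · rw [if_neg hk, if_neg (mt e.2 hk), map_zero, smul_zero]
  · have e : ((k + 1 : ℕ) : ZMod Q.p) = m + n ↔ (k : ZMod Q.p) = m' + n := by
      rw [h, Nat.cast_succ]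
      constructor <;> intro h'
      · linear_combination h'
      · linear_combination h'
    by_cases hk' : ((k + 1 : ℕ) : ZMod Q.p) = m + n
    · rw [if_pos hk', if_pos (e.1 hk'), RP_coef_succ _ _ _ _ hk]
    · rw [if_neg hk', if_neg (mt e.2 hk'), map_zero, smul_zero]

/-- As `RP_D`, with the power of `η₋` shifted cyclically downwards for each fixed power of `η₊`. -/
theorem RM_D {m m' : ℕ} (hm : m ≤ Q.p) (hm' : m' ≤ Q.p) (h : (m' : ZMod Q.p) = m + 1) :
    RM Q (D Q lP lM m 0) = lM • D Q lP lM m' 0 := by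
  rw [D_zero _ _ hm, D_zero _ _ hm', map_sum, Finset.smul_sum]
  refine sum_range_cyclic (by have := Q.one_lt_p; omega) _ _ ?_ fun n hn => ?_
  · rw [map_sum, Finset.smul_sum]
    refine Finset.sum_congr rfl fun k _ => ?_
    have e : (k : ZMod Q.p) = m + (0 : ℕ) ↔ (k : ZMod Q.p) = m' + (Q.p - 1 : ℕ) := by
      rw [natCast_pred, h, Nat.cast_zero]
      ring_nf
    by_cases hk : (k : ZMod Q.p) = m + (0 : ℕ)
    · rw [if_pos hk, if_pos (e.1 hk), RM_coef_zero]
    · rw [if_neg hk, if_neg (mt e.2 hk), map_zero, smul_zero]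
  · rw [map_sum, Finset.smul_sum]
    refine Finset.sum_congr rfl fun k _ => ?_
    have e : (k : ZMod Q.p) = m + (n + 1 : ℕ) ↔ (k : ZMod Q.p) = m' + n := by
      rw [h, Nat.cast_succ]
      ring_nf
    by_cases hk : (k : ZMod Q.p) = m + (n + 1 : ℕ)
    · rw [if_pos hk, if_pos (e.1 hk), RM_coef_succ _ _ _ _ hn]
    · rw [if_neg hk, if_neg (mt e.2 hk), map_zero, smul_zero]

end

end QPoincare

end

theorem proposition3 (Q : QPoincare.RootParam) (lP lM : ℂ) :
    (∀ m : ℕ, 1 ≤ m → m ≤ Q.p - 1 →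
      QPoincare.RP Q (QPoincare.D Q lP lM m 0) = lP • QPoincare.D Q lP lM (m - 1) 0) ∧
    (∀ m : ℕ, m ≤ Q.p - 2 →
      QPoincare.RM Q (QPoincare.D Q lP lM m 0) = lM • QPoincare.D Q lP lM (m + 1) 0) ∧
    QPoincare.RP Q (QPoincare.D Q lP lM 0 0) = lP • QPoincare.D Q lP lM (Q.p - 1) 0 ∧
    QPoincare.RM Q (QPoincare.D Q lP lM (Q.p - 1) 0) = lM • QPoincare.D Q lP lM 0 0 := by
  have hp := Q.one_lt_p
  refine ⟨fun m h1 h2 => ?_, fun m h => ?_, ?_, ?_⟩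
  · refine QPoincare.RP_D lP lM (by omega) (by omega) ?_
    rw [Nat.cast_sub h1]; simp
  · exact QPoincare.RM_D lP lM (by omega) (by omega) (by push_cast; rfl)
  · refine QPoincare.RP_D lP lM (by omega) (by omega) ?_
    rw [QPoincare.natCast_pred]; simp
  · refine QPoincare.RM_D lP lM (by omega) (by omega) ?_
    rw [QPoincare.natCast_pred]; simp
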